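/- For every real $K>0$ there is a constant $C>0$, depending only on $K$, such that the following holds for every prime power $q$, where $\mathbb F_q$ is the finite field with $q$ elements. Let $A,B\subset\mathbb F_q$ with $2\le |B|\le |A|$, and suppose that $$|A\cap(cG+d)|\le K\max\{|G|^{1/2},\ |A|^{31/191}|B|^{129/191}\}$$ for all proper subfields $G$ of $\mathbb F_q$ and all $c,d\in\mathbb F_q$. Let $T(A,B)$ be the number of sextuples $(a_1,a_2,a_3,b_1,b_2,b_3)\in A^3\times B^3$ with $(a_2-a_1)(b_3-b_1)=(a_3-a_1)(b_2-b_1)$. For a finite set $P\subset\mathbb F_q^2$ and a set $L$ of lines in $\mathbb F_q^2$, let $I(P,L)=|\{(p,l)\in P\times L: p\in l\}|$, and let $L(P)$ be the number of distinct lines determined by pairs of distinct points of $P$. Then $$T(A,B)\le C\big(|A|^{383/191}|B|^{571/191}+q^{-1/103}|A|^{207/103}|B|^3+|A|^3|B|\big);$$ for every set $L$ of lines in $\mathbb F_q^2$, $$I(A\times B,L)\le C\Big(\big(|A|^{383/573}|B|^{571/573}+q^{-1/309}|A|^{207/309}|B|+|A||B|^{1/3}\big)|L|^{2/3}+|L|\Big);$$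 and $$\min\{|A|^{380/191}|B|^{4/191},\ q^{2/103}|A|^{204/103},\ |B|^4\}\le C\,L(A\times B).$$ -/

import Mathlib

/-- A line in the affine plane `F²`: the solution set of a nontrivial equation `a x + b y = c`. -/
def IsLine {F : Type*} [Field F] (l : Set (F × F)) : Prop :=
  ∃ a b c : F, (a ≠ 0 ∨ b ≠ 0) ∧ l = {p : F × F | a * p.1 + b * p.2 = c}

open Classical in
/-- The number `I(P, L)` of incidences, i.e. of pairs `(p, l) ∈ P × L` with `p ∈ l`. -/
noncomputable def incidences {F : Type*} (P : Finset (F × F)) (L : Finset (Set (F × F))) : ℕ :=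
  ((P ×ˢ L).filter fun x => x.1 ∈ x.2).card

open Classical in
/-- The number `T(A, B)` of collinear triples of `A × B`: sextuples
`((a₁, a₂, a₃), (b₁, b₂, b₃)) ∈ A³ × B³` with
`(a₂ - a₁) (b₃ - b₁) = (a₃ - a₁) (b₂ - b₁)`. -/
noncomputable def collinearTriples {F : Type*} [Field F] (A B : Finset F) : ℕ :=
  (((A ×ˢ A ×ˢ A) ×ˢ (B ×ˢ B ×ˢ B)).filter fun x =>
    (x.1.2.1 - x.1.1) * (x.2.2.2 - x.2.1) = (x.1.2.2 - x.1.1) * (x.2.2.1 - x.2.1)).card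

/-- The number `L(P)` of distinct lines determined by pairs of distinct points of `P`. -/
noncomputable def linesDetermined {F : Type*} [Field F] (P : Finset (F × F)) : ℕ :=
  {l : Set (F × F) | IsLine l ∧ ∃ p ∈ P, ∃ p' ∈ P, p ≠ p' ∧ p ∈ l ∧ p' ∈ l}.ncard

section

open Finset
open scoped Pointwise

/-! Suppose `A × B` has at least |A|²|B|³/M non-degenerate collinear triples. Fixing two popular
heights and reparametrising the third by s = (b - b₁)/(b₂ - b), collinearity says that x + s v ∈ (1
+ s) A for many x, v ∈ A and many s. A Balog–Szemerédi–Gowers argument then gives dense X, V ⊆ A and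
a large set T of pivots such that X + tV has size at most a power of M times |A| for all t ∈ T,
while T has an affine copy inside X (`exists_subsets_card_add_smul_le`). A sum-product dichotomy for
T follows. If the ratio set R of T ∪ {0} is not closed under r ↦ 1 + r and r ↦ (t/u) r, some ρ ∉ R
is obtained in one step from R. The map (x, y) ↦ x - ρy is injective on T × T, so T - ρT has |T|²
elements, yet Plünnecke and Ruzsa inequalities make it small. This bounds |B|² by a power of M times
|A|. If R is closed, it is a subfield G with T in a dilate of G and V - rV small for all r ∈ G
(`exists_subfield_or_card_le`). Averaging over r ∈ G shows |V|² or |G| is at most a power of M times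
|A|. When G is the whole field this compares q with |A|; when G is proper, the hypothesis on A
bounds |T|. `bounds_of_properTriples` collects these outcomes, and `collinearTriples_bound` checks
that each contradicts a triple count above the claimed bound. The incidence and line bounds follow
since the sum of |l ∩ (A × B)|³ over lines l with at least two points is at most 2T(A, B). -/

/-! ### Paths of length three in dense bipartite graphs. -/

set_option maxHeartbeats 1000000 in
/-- A form of the Balog–Szemerédi–Gowers theorem for bipartite graphs: a graph of density `1 / K`
has large vertex classes `X`, `V`, spanning many edges, such that any `x ∈ X` and `v ∈ V` are
joined by many paths of length three. -/
theorem exists_dense_paths {α β : Type*} [DecidableEq α] [DecidableEq β]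
    (A : Finset α) (B : Finset β) (H : Finset (α × β)) (hH : H ⊆ A ×ˢ B) (K : ℝ) (hK : 0 < K)
    (hA : A.Nonempty) (hB : B.Nonempty)
    (h : (#A : ℝ) * #B / K ≤ #H) :
    ∃ X ⊆ A, ∃ V ⊆ B, (#A : ℝ) / (6 * K) ≤ #X ∧ (#B : ℝ) / (8 * K) ≤ #V ∧
      (#A : ℝ) * #B / (24 * K ^ 2) ≤ #{p ∈ X ×ˢ V | p ∈ H} ∧
      ∀ x ∈ X, ∀ v ∈ V, (#A : ℝ) * #B / (12288 * K ^ 5) ≤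
        #{p ∈ A ×ˢ B | (x, p.2) ∈ H ∧ p ∈ H ∧ (p.1, v) ∈ H} := by
  have ha : (0 : ℝ) < #A := by exact_mod_cast hA.card_pos
  have hb : (0 : ℝ) < #B := by exact_mod_cast hB.card_pos
  set a : ℝ := (#A : ℝ) with ha_def
  set b : ℝ := (#B : ℝ) with hb_def
  clear_value a b
  have edge : ∀ (X : Finset α) (V : Finset β),
      (#{p ∈ X ×ˢ V | p ∈ H} : ℝ) = ∑ x ∈ X, (#{v ∈ V | (x, v) ∈ H} : ℝ) := by
    intro X V
    simp only [card_filter, sum_product]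
    push_cast
    rfl
  have edge' : ∀ (X : Finset α) (V : Finset β),
      (#{p ∈ X ×ˢ V | p ∈ H} : ℝ) = ∑ v ∈ V, (#{x ∈ X | (x, v) ∈ H} : ℝ) := by
    intro X V
    simp only [card_filter, sum_product_right]
    push_cast
    rfl
  have hHe : (#H : ℝ) = #{p ∈ A ×ˢ B | p ∈ H} := by
    congr 2
    ext p
    simp only [mem_filter]
    exact ⟨fun hp => ⟨hH hp, hp⟩, fun hp => hp.2⟩

  set A₁ : Finset α := {x ∈ A | b / (2 * K) ≤ #{v ∈ B | (x, v) ∈ H}} with hA₁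
  have hA₁A : A₁ ⊆ A := filter_subset _ _
  have hA₁c : (#A₁ : ℝ) ≤ a := by rw [ha_def]; exact_mod_cast card_le_card hA₁A
  have h1 : a * b / (2 * K) ≤ ∑ x ∈ A₁, (#{v ∈ B | (x, v) ∈ H} : ℝ) := by
    have hs := sum_filter_add_sum_filter_not A
      (fun x => b / (2 * K) ≤ (#{v ∈ B | (x, v) ∈ H} : ℝ))
      (fun x => (#{v ∈ B | (x, v) ∈ H} : ℝ))
    rw [← edge A B, ← hHe] at hs
    have h2 : ∑ x ∈ A with ¬ (b / (2 * K) ≤ (#{v ∈ B | (x, v) ∈ H} : ℝ)),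
        (#{v ∈ B | (x, v) ∈ H} : ℝ) ≤ a * (b / (2 * K)) := by
      calc _ ≤ ∑ x ∈ A with ¬ (b / (2 * K) ≤ (#{v ∈ B | (x, v) ∈ H} : ℝ)), b / (2 * K) := by
            apply sum_le_sum
            intro x hx
            exact (not_le.1 (mem_filter.1 hx).2).le
        _ ≤ ∑ x ∈ A, b / (2 * K) :=
            sum_le_sum_of_subset_of_nonneg (filter_subset _ _) (fun _ _ _ => by positivity)
        _ = a * (b / (2 * K)) := by rw [sum_const, nsmul_eq_mul, ha_def]
    have e1 : a * b / K = a * (b / (2 * K)) + a * (b / (2 * K)) := by field_simp; ring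
    have e2 : a * b / (2 * K) = a * (b / (2 * K)) := by ring
    rw [e2]
    linarith

  -- Dependent random choice: a pair in `D` has few common neighbours, so it rarely lies in the
  -- neighbourhood of a given `v`.
  set Nb : β → Finset α := fun v => {x ∈ A₁ | (x, v) ∈ H} with hNb
  set cod : α → α → ℝ := fun x x' => (#{v ∈ B | (x, v) ∈ H ∧ (x', v) ∈ H} : ℝ) with hcod
  set D : Finset (α × α) := {p ∈ A₁ ×ˢ A₁ | cod p.1 p.2 < b / (256 * K ^ 3)} with hD
  set bad : β → ℝ := fun v => (#{p ∈ Nb v ×ˢ Nb v | p ∈ D} : ℝ) with hbad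
  have h2 : (a * b / (2 * K)) ^ 2 ≤ b * ∑ v ∈ B, (#(Nb v) : ℝ) ^ 2 := by
    have hsum : ∑ v ∈ B, (#(Nb v) : ℝ) = ∑ x ∈ A₁, (#{v ∈ B | (x, v) ∈ H} : ℝ) := by
      rw [← edge, ← edge']
    have := sq_sum_le_card_mul_sum_sq (s := B) (f := fun v => (#(Nb v) : ℝ))
    rw [hsum, ← hb_def] at this
    refine le_trans ?_ this
    gcongr
  have h3 : ∑ v ∈ B, bad v ≤ a ^ 2 * (b / (256 * K ^ 3)) := by
    have e : ∑ v ∈ B, bad v = ∑ p ∈ D, cod p.1 p.2 := by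
      have : ∀ v, {p ∈ Nb v ×ˢ Nb v | p ∈ D} = {p ∈ D | (p.1, v) ∈ H ∧ (p.2, v) ∈ H} := by
        intro v
        ext p
        simp only [hNb, hD, mem_filter, mem_product]
        tauto
      simp only [hbad, this, hcod, card_filter]
      push_cast
      rw [sum_comm]
    rw [e]
    calc _ ≤ ∑ p ∈ D, b / (256 * K ^ 3) :=
          sum_le_sum fun p hp => (mem_filter.1 hp).2.le
      _ = (#D : ℝ) * (b / (256 * K ^ 3)) := by simp
      _ ≤ a ^ 2 * (b / (256 * K ^ 3)) := by
          gcongr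
          calc (#D : ℝ) ≤ #(A₁ ×ˢ A₁) := by exact_mod_cast card_le_card (filter_subset _ _)
            _ = (#A₁ : ℝ) ^ 2 := by rw [card_product]; push_cast; ring
            _ ≤ a ^ 2 := by gcongr
  -- On average the first term is at least a²/(4K²) and the second at most a²/(8K²). One inequality
  -- thus gives both a large neighbourhood and a bad-pair proportion of at most 1/(32K) in it.
  obtain ⟨v₀, hv₀, hv₀'⟩ : ∃ v ∈ B, a ^ 2 / (8 * K ^ 2) ≤ (#(Nb v) : ℝ) ^ 2 - 32 * K * bad v := by
    apply exists_le_of_sum_le hB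
    rw [sum_sub_distrib, ← mul_sum, sum_const, nsmul_eq_mul, ← hb_def]
    have e1 : a ^ 2 * b / (4 * K ^ 2) ≤ ∑ v ∈ B, (#(Nb v) : ℝ) ^ 2 := by
      have : b * (a ^ 2 * b / (4 * K ^ 2)) ≤ b * ∑ v ∈ B, (#(Nb v) : ℝ) ^ 2 := by
        convert h2 using 1
        field_simp
        ring
      exact le_of_mul_le_mul_left this hb
    have e2 : 32 * K * ∑ v ∈ B, bad v ≤ a ^ 2 * b / (8 * K ^ 2) := by
      calc _ ≤ 32 * K * (a ^ 2 * (b / (256 * K ^ 3))) := by gcongr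
        _ = _ := by field_simp; ring
    have e3 : b * (a ^ 2 / (8 * K ^ 2)) = a ^ 2 * b / (4 * K ^ 2) - a ^ 2 * b / (8 * K ^ 2) := by
      field_simp; ring
    rw [e3]
    linarith
  set A' := Nb v₀ with hA'
  set p : ℝ := (#A' : ℝ) with hp
  have hbad0 : 0 ≤ bad v₀ := by positivity
  have hp0 : 0 ≤ p := by positivity
  have hpa : a / (3 * K) ≤ p := by
    apply le_of_sq_le_sq _ hp0
    have : (a / (3 * K)) ^ 2 ≤ a ^ 2 / (8 * K ^ 2) := by
      rw [div_pow, mul_pow]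
      gcongr
      norm_num
    nlinarith
  have hppos : 0 < p := lt_of_lt_of_le (by positivity) hpa
  have hbadp : bad v₀ ≤ p ^ 2 / (32 * K) := by
    rw [le_div_iff₀ (by positivity)]
    have : 0 ≤ a ^ 2 / (8 * K ^ 2) := by positivity
    nlinarith
  set bd : α → ℝ := fun x => (#{x' ∈ A' | (x, x') ∈ D} : ℝ) with hbd
  set X : Finset α := {x ∈ A' | bd x ≤ p / (16 * K)} with hX
  have hXA' : X ⊆ A' := filter_subset _ _
  have hA'A : A' ⊆ A₁ := filter_subset _ _
  have hXp : p / 2 ≤ #X := by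
    have e1 : ∑ x ∈ A', bd x = bad v₀ := by
      simp only [hbad, hbd, card_filter, sum_product]
      push_cast
      rfl
    have e2 : (#(A' \ X) : ℝ) * (p / (16 * K)) ≤ bad v₀ := by
      rw [← e1]
      calc _ = ∑ x ∈ A' \ X, p / (16 * K) := by simp
        _ ≤ ∑ x ∈ A' \ X, bd x := by
            apply sum_le_sum
            intro x hx
            simp only [hX, mem_sdiff, mem_filter, not_and, not_le] at hx
            exact (hx.2 hx.1).le
        _ ≤ ∑ x ∈ A', bd x :=
            sum_le_sum_of_subset_of_nonneg sdiff_subset (fun _ _ _ => by positivity)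
    have e3 : (#(A' \ X) : ℝ) = p - #X := by
      rw [cast_card_sdiff hXA']
    rw [e3] at e2
    have e4 : (p - #X) * (p / (16 * K)) ≤ (p / 2) * (p / (16 * K)) := by
      calc _ ≤ p ^ 2 / (32 * K) := e2.trans hbadp
        _ = _ := by field_simp; ring
    have := le_of_mul_le_mul_right e4 (by positivity)
    linarith
  set V : Finset β := {v ∈ B | p / (8 * K) ≤ #{x ∈ A' | (x, v) ∈ H}} with hV
  have hVB : V ⊆ B := filter_subset _ _
  have hE : p * b / (8 * K) ≤ #{q ∈ X ×ˢ V | q ∈ H} := by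
    have e1 : (p / 2) * (b / (2 * K)) ≤ #{q ∈ X ×ˢ B | q ∈ H} := by
      rw [edge]
      calc _ ≤ (#X : ℝ) * (b / (2 * K)) := by gcongr
        _ = ∑ x ∈ X, b / (2 * K) := by simp
        _ ≤ _ := sum_le_sum fun x hx => (mem_filter.1 (hA'A (hXA' hx))).2
    have e2 : (#{q ∈ X ×ˢ (B \ V) | q ∈ H} : ℝ) ≤ b * (p / (8 * K)) := by
      rw [edge']
      calc _ ≤ ∑ v ∈ B \ V, p / (8 * K) := by
            apply sum_le_sum
            intro v hv
            simp only [hV, mem_sdiff, mem_filter, not_and, not_le] at hv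
            refine le_trans ?_ (hv.2 hv.1).le
            exact_mod_cast card_le_card (filter_subset_filter _ hXA')
        _ ≤ ∑ v ∈ B, p / (8 * K) :=
            sum_le_sum_of_subset_of_nonneg sdiff_subset (fun _ _ _ => by positivity)
        _ = _ := by rw [sum_const, nsmul_eq_mul, hb_def]
    have e3 : (#{q ∈ X ×ˢ B | q ∈ H} : ℝ)
        = #{q ∈ X ×ˢ (B \ V) | q ∈ H} + #{q ∈ X ×ˢ V | q ∈ H} := by
      rw [edge', edge', edge', sum_sdiff hVB]
    have e4 : p * b / (8 * K) = (p / 2) * (b / (2 * K)) - b * (p / (8 * K)) := by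
      field_simp; ring
    linarith
  refine ⟨X, hXA'.trans (hA'A.trans hA₁A), V, hVB, ?_, ?_, ?_, ?_⟩
  · calc a / (6 * K) = (a / (3 * K)) / 2 := by field_simp; ring
      _ ≤ p / 2 := by gcongr
      _ ≤ _ := hXp
  · have e1 : (#{q ∈ X ×ˢ V | q ∈ H} : ℝ) ≤ p * #V := by
      calc (#{q ∈ X ×ˢ V | q ∈ H} : ℝ) ≤ #(X ×ˢ V) := by
            exact_mod_cast card_le_card (filter_subset _ _)
        _ = (#X : ℝ) * #V := by rw [card_product]; push_cast; ring
        _ ≤ p * #V := by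
            gcongr
            rw [hp]
            exact_mod_cast card_le_card hXA'
    have e2 : p * (b / (8 * K)) ≤ p * #V := by
      calc _ = p * b / (8 * K) := by ring
        _ ≤ _ := hE.trans e1
    exact le_of_mul_le_mul_left e2 hppos
  · refine le_trans ?_ hE
    calc a * b / (24 * K ^ 2) = (a / (3 * K)) * b / (8 * K) := by field_simp; ring
      _ ≤ _ := by gcongr
  · intro x hx v hv
    -- Paths x – y – x' – v: `v` has at least p/(8K) neighbours x' in `A'`, at most half that number
    -- are bad partners of `x`, and each remaining x' shares many neighbours y with `x`.
    set good : Finset α := {x' ∈ A' | (x', v) ∈ H ∧ (x, x') ∉ D} with hgood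
    have g1 : p / (16 * K) ≤ #good := by
      have e1 : p / (8 * K) ≤ #{x' ∈ A' | (x', v) ∈ H} := (mem_filter.1 hv).2
      have e2 : bd x ≤ p / (16 * K) := (mem_filter.1 hx).2
      have e3 : (#{x' ∈ A' | (x', v) ∈ H} : ℝ) ≤ #good + bd x := by
        simp only [hbd, hgood]
        norm_cast
        refine le_trans (card_le_card ?_) (card_union_le _ _)
        intro y hy
        simp only [mem_union, mem_filter] at hy ⊢
        tauto
      have e4 : p / (8 * K) = p / (16 * K) + p / (16 * K) := by field_simp; ring
      linarith
    have g2 : ∀ x' ∈ good, b / (256 * K ^ 3) ≤ cod x x' := by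
      intro x' hx'
      simp only [hgood, hD, mem_filter, mem_product, not_and, not_lt] at hx'
      exact hx'.2.2 ⟨hA'A (hXA' hx), hA'A hx'.1⟩
    have g3 : (∑ x' ∈ good, cod x x')
        ≤ #{p ∈ A ×ˢ B | (x, p.2) ∈ H ∧ p ∈ H ∧ (p.1, v) ∈ H} := by
      have : (∑ x' ∈ good, cod x x')
          = #{p ∈ good ×ˢ B | (x, p.2) ∈ H ∧ (p.1, p.2) ∈ H} := by
        simp only [hcod, card_filter, sum_product]
        push_cast
        rfl
      rw [this]
      norm_cast
      apply card_le_card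
      intro q hq
      simp only [hgood, mem_filter, mem_product] at hq ⊢
      exact ⟨⟨hA₁A (hA'A hq.1.1.1), hq.1.2⟩, hq.2.1, hq.2.2, hq.1.1.2.1⟩
    refine le_trans ?_ g3
    calc a * b / (12288 * K ^ 5) = (a / (3 * K)) / (16 * K) * (b / (256 * K ^ 3)) := by
          field_simp; ring
      _ ≤ p / (16 * K) * (b / (256 * K ^ 3)) := by gcongr
      _ ≤ #good * (b / (256 * K ^ 3)) := by gcongr
      _ = ∑ x' ∈ good, b / (256 * K ^ 3) := by simp
      _ ≤ _ := sum_le_sum g2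

/-! ### Sums with dilates and the set of pivots. -/

theorem card_smul_eq {F : Type*} [Field F] [DecidableEq F] {s : F} (hs : s ≠ 0) (V : Finset F) :
    #(s • V) = #V := card_image_of_injective _ (mul_right_injective₀ hs)

theorem smul_sub_eq {F : Type*} [Field F] [DecidableEq F] (s : F) (V W : Finset F) :
    s • (V - W) = s • V - s • W := by
  ext y
  simp only [mem_smul_finset, mem_sub, smul_eq_mul]
  constructor
  · rintro ⟨_, ⟨v, hv, w, hw, rfl⟩, rfl⟩
    exact ⟨_, ⟨v, hv, rfl⟩, _, ⟨w, hw, rfl⟩, (mul_sub _ _ _).symm⟩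
  · rintro ⟨_, ⟨v, hv, rfl⟩, _, ⟨w, hw, rfl⟩, rfl⟩
    exact ⟨_, ⟨v, hv, w, hw, rfl⟩, mul_sub _ _ _⟩

/-- A path x – y – x' – v writes x + sv as (x + sy) - (x' + sy) + (x' + sv) with all three terms in
`Λ`, and distinct paths give distinct triples. -/
theorem card_add_smul_mul_le {F : Type*} [Field F] [DecidableEq F] {A X V Λ : Finset F}
    {H : Finset (F × F)} {s : F} (hs : s ≠ 0) (hH : ∀ p ∈ H, p.1 + s * p.2 ∈ Λ) {P : ℝ}
    (hP : ∀ x ∈ X, ∀ v ∈ V, P ≤ #{p ∈ A ×ˢ A | (x, p.2) ∈ H ∧ p ∈ H ∧ (p.1, v) ∈ H}) :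
    (#(X + s • V) : ℝ) * P ≤ (#Λ : ℝ) ^ 3 := by
  have key : ∀ w ∈ X + s • V, P ≤
      #{t ∈ Λ ×ˢ Λ ×ˢ Λ | t.1 - t.2.1 + t.2.2 = w} := by
    intro w hw
    obtain ⟨x, hx, y, hy, rfl⟩ := mem_add.1 hw
    obtain ⟨v, hv, rfl⟩ := mem_smul_finset.1 hy
    refine (hP x hx v hv).trans ?_
    norm_cast
    refine card_le_card_of_injOn
      (fun p => (x + s * p.2, p.1 + s * p.2, p.1 + s * v)) ?_ ?_
    · intro p hp
      simp only [coe_filter, Set.mem_ofPred_eq, mem_product] at hp ⊢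
      refine ⟨⟨hH _ hp.2.1, hH _ hp.2.2.1, hH _ hp.2.2.2⟩, ?_⟩
      simp only [smul_eq_mul]
      ring
    · intro p _ q _ hpq
      simp only [Prod.mk.injEq, add_right_inj, add_left_inj, mul_eq_mul_left_iff, hs,
        or_false] at hpq
      exact Prod.ext hpq.2.2 hpq.1
  calc (#(X + s • V) : ℝ) * P = ∑ w ∈ X + s • V, P := by rw [sum_const, nsmul_eq_mul]
    _ ≤ ∑ w ∈ X + s • V, (#{t ∈ Λ ×ˢ Λ ×ˢ Λ | t.1 - t.2.1 + t.2.2 = w} : ℝ) := sum_le_sum key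
    _ ≤ #(Λ ×ˢ Λ ×ˢ Λ) := by
        norm_cast
        rw [sum_card_fiberwise_eq_card_filter]
        exact card_le_card (filter_subset _ _)
    _ = (#Λ : ℝ) ^ 3 := by simp only [card_product]; push_cast; ring

theorem card_sub_self_mul_le {F : Type*} [Field F] [DecidableEq F] (X V : Finset F) (s : F)
    (hs : s ≠ 0) : #(X - X) * #V ≤ #(X + s • V) ^ 2 := by
  have := ruzsa_triangle_inequality_sub_add_add X (s • V) X
  rwa [card_smul_eq hs, ← sq] at this

theorem card_sub_self_mul_le' {F : Type*} [Field F] [DecidableEq F] (X V : Finset F) (s : F)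
    (hs : s ≠ 0) : #(V - V) * #X ≤ #(X + s • V) ^ 2 := by
  have := ruzsa_triangle_inequality_sub_add_add (s • V) X (s • V)
  rwa [← smul_sub_eq, card_smul_eq hs, add_comm (s • V) X, ← sq] at this

/-- Since sW ⊆ z - X, the set X + sW lies in a translate of X - X. The Ruzsa triangle inequality
through sW then passes from W to V. -/
theorem card_add_smul_mul_le_of_subset {F : Type*} [Field F] [DecidableEq F] {X V W : Finset F}
    {s z : F} (hW : ∀ w ∈ W, z - s * w ∈ X) (hWV : W ⊆ V) (hs : s ≠ 0) :
    #(X + s • V) * #W ≤ #(X - X) * #(V - V) := by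
  have h := ruzsa_triangle_inequality_add_add_negAdd X (s • W) (s • V)
  rw [card_smul_eq hs, neg_add_eq_sub, ← smul_sub_eq, card_smul_eq hs] at h
  refine h.trans (Nat.mul_le_mul ?_ (card_le_card (sub_subset_sub_right hWV)))
  have hsub : X + s • W ⊆ (X - X).image (· + z) := by
    intro y hy
    obtain ⟨x, hx, u, hu, rfl⟩ := mem_add.1 hy
    obtain ⟨w, hw, rfl⟩ := mem_smul_finset.1 hu
    refine mem_image.2 ⟨x - (z - s * w), sub_mem_sub hx (hW w hw), ?_⟩
    simp only [smul_eq_mul]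
    ring
  exact (card_le_card hsub).trans card_image_le

/-- Both difference sets cost M¹¹ = (M⁵)²·M, and dividing by w costs M³, whence the exponent 25 = 11
+ 11 + 3. -/
theorem card_add_smul_le_of_le {F : Type*} [Field F] [DecidableEq F] {X V : Finset F} {s₀ t : F}
    {a M : ℝ} {w : ℕ} (ha : 0 < a) (hM : 0 < M) (hX' : a / (12 * M) ≤ #X)
    (hV' : a / (16 * M) ≤ #V) (hwc : a / (384 * M ^ 3) ≤ w)
    (hsum₀ : (#(X + s₀ • V) : ℝ) ≤ 393216 * M ^ 5 * a)
    (k1 : #(X + t • V) * w ≤ #(X - X) * #(V - V))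
    (k2 : #(X - X) * #V ≤ #(X + s₀ • V) ^ 2) (k3 : #(V - V) * #X ≤ #(X + s₀ • V) ^ 2) :
    (#(X + t • V) : ℝ) ≤ 73728 * 393216 ^ 4 * M ^ 25 * a := by
  have k1' : (#(X + t • V) : ℝ) * w ≤ #(X - X) * #(V - V) := by exact_mod_cast k1
  have k2' : (#(X - X) : ℝ) * #V ≤ (#(X + s₀ • V) : ℝ) ^ 2 := by exact_mod_cast k2
  have k3' : (#(V - V) : ℝ) * #X ≤ (#(X + s₀ • V) : ℝ) ^ 2 := by exact_mod_cast k3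
  have j2 : (#(X - X) : ℝ) ≤ 16 * 393216 ^ 2 * M ^ 11 * a := by
    have : (#(X - X) : ℝ) * (a / (16 * M)) ≤ (393216 * M ^ 5 * a) ^ 2 :=
      calc _ ≤ (#(X - X) : ℝ) * #V := by gcongr
        _ ≤ _ := k2'
        _ ≤ _ := by gcongr
    refine le_of_mul_le_mul_right (this.trans (le_of_eq ?_)) (by positivity)
    field_simp
  have j3 : (#(V - V) : ℝ) ≤ 12 * 393216 ^ 2 * M ^ 11 * a := by
    have : (#(V - V) : ℝ) * (a / (12 * M)) ≤ (393216 * M ^ 5 * a) ^ 2 :=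
      calc _ ≤ (#(V - V) : ℝ) * #X := by gcongr
        _ ≤ _ := k3'
        _ ≤ _ := by gcongr
    refine le_of_mul_le_mul_right (this.trans (le_of_eq ?_)) (by positivity)
    field_simp
  have j1 : (#(X + t • V) : ℝ) * (a / (384 * M ^ 3)) ≤
      (16 * 393216 ^ 2 * M ^ 11 * a) * (12 * 393216 ^ 2 * M ^ 11 * a) :=
    calc _ ≤ (#(X + t • V) : ℝ) * w := by gcongr
      _ ≤ _ := k1'
      _ ≤ _ := by gcongr
  refine le_of_mul_le_mul_right (j1.trans (le_of_eq ?_))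
    (by positivity : 0 < a / (384 * M ^ 3))
  field_simp
  norm_num

/-- Many solutions of `x + s v ∈ (1 + s) A` with `x, v ∈ A` and `s ∈ S` produce large subsets
`X, V ⊆ A`, together with a large subset `T` of `S`, affinely embedded in `X`, such that all
`X + t V` with `t ∈ T` are small. -/
theorem exists_subsets_card_add_smul_le {F : Type*} [Field F] [DecidableEq F] (A S : Finset F)
    (n M : ℝ) (hM : 0 < M) (hn : 0 < n) (hSn : (#S : ℝ) ≤ n) (hA : A.Nonempty) (h0 : 0 ∉ S)
    (h1 : ∀ s ∈ S, 1 + s ≠ 0)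
    (h : (#A : ℝ) ^ 2 * n / M ≤
      ∑ s ∈ S, (#{p ∈ A ×ˢ A | p.1 ≠ p.2 ∧ (p.1 + s * p.2) / (1 + s) ∈ A} : ℝ)) :
    ∃ X ⊆ A, ∃ V ⊆ A, ∃ T ⊆ S, ∃ s c d : F, s ≠ 0 ∧ c ≠ 0 ∧
      (#A : ℝ) / (12 * M) ≤ #X ∧ (#A : ℝ) / (16 * M) ≤ #V ∧ n / (384 * M ^ 3) ≤ #T ∧
      (#(X + s • V) : ℝ) ≤ 393216 * M ^ 5 * #A ∧ (∀ t ∈ T, t * c + d ∈ X) ∧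
      ∀ t ∈ T, (#(X + t • V) : ℝ) ≤ 73728 * 393216 ^ 4 * M ^ 25 * #A := by
  have ha : (0 : ℝ) < #A := by exact_mod_cast hA.card_pos
  set a : ℝ := (#A : ℝ) with ha_def
  set G : F → Finset (F × F) := fun s =>
    {p ∈ A ×ˢ A | p.1 ≠ p.2 ∧ (p.1 + s * p.2) / (1 + s) ∈ A} with hG
  set f : F × F → ℝ := fun p => (#{s ∈ S | p ∈ G s} : ℝ) with hf
  have swap : ∀ (S' : Finset F) (E : Finset (F × F)),
      ∑ s ∈ S', (#{p ∈ E | p ∈ G s} : ℝ) = ∑ p ∈ E, (#{s ∈ S' | p ∈ G s} : ℝ) := by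
    intro S' E
    simp only [card_filter]
    push_cast
    exact sum_comm
  have hGA : ∀ s, G s ⊆ A ×ˢ A := fun s => filter_subset _ _
  -- Restricting to pairs that work for many s ensures that every edge of the graph at the single
  -- parameter `s₀` is also an edge for many other s.
  set R : Finset (F × F) := {p ∈ A ×ˢ A | n / (2 * M) ≤ f p} with hR
  have hRA : R ⊆ A ×ˢ A := filter_subset _ _
  have hRsum : a ^ 2 * n / (2 * M) ≤ ∑ s ∈ S, (#{p ∈ R | p ∈ G s} : ℝ) := by
    have e0 : ∀ s, (#(G s) : ℝ) = #{p ∈ A ×ˢ A | p ∈ G s} := by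
      intro s
      rw [filter_mem_eq_inter, inter_eq_right.2 (hGA s)]
    have e1 : a ^ 2 * n / M ≤ ∑ p ∈ A ×ˢ A, f p := by
      rw [hf, ← swap]
      refine h.trans (le_of_eq ?_)
      exact sum_congr rfl fun s _ => e0 s
    rw [swap]
    have hs := sum_filter_add_sum_filter_not (A ×ˢ A) (fun p => n / (2 * M) ≤ f p) f
    have e2 : ∑ p ∈ A ×ˢ A with ¬ (n / (2 * M) ≤ f p), f p ≤ a ^ 2 * (n / (2 * M)) := by
      calc _ ≤ ∑ p ∈ A ×ˢ A with ¬ (n / (2 * M) ≤ f p), n / (2 * M) :=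
            sum_le_sum fun p hp => (not_le.1 (mem_filter.1 hp).2).le
        _ ≤ ∑ p ∈ A ×ˢ A, n / (2 * M) :=
            sum_le_sum_of_subset_of_nonneg (filter_subset _ _) (fun _ _ _ => by positivity)
        _ = _ := by
            rw [sum_const, nsmul_eq_mul, card_product, ha_def]
            push_cast
            ring
    have e3 : a ^ 2 * n / M = a ^ 2 * n / (2 * M) + a ^ 2 * (n / (2 * M)) := by field_simp; ring
    change _ ≤ ∑ p ∈ R, f p
    linarith
  obtain ⟨s₀, hs₀, hs₀E⟩ : ∃ s ∈ S, a ^ 2 / (2 * M) ≤ (#{p ∈ R | p ∈ G s} : ℝ) := by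
    have hSne : S.Nonempty := by
      rw [nonempty_iff_ne_empty]
      rintro rfl
      rw [sum_empty] at hRsum
      have : 0 < a ^ 2 * n / (2 * M) := by positivity
      linarith
    apply exists_le_of_sum_le hSne
    rw [sum_const, nsmul_eq_mul]
    refine le_trans ?_ hRsum
    calc (#S : ℝ) * (a ^ 2 / (2 * M)) ≤ n * (a ^ 2 / (2 * M)) := by gcongr
      _ = _ := by ring
  set H : Finset (F × F) := {p ∈ R | p ∈ G s₀} with hH
  have hHA : H ⊆ A ×ˢ A := (filter_subset _ _).trans hRA
  obtain ⟨X, hXA, V, hVA, hX, hV, hE, hpath⟩ :=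
    exists_dense_paths A A H hHA (2 * M) (by positivity) hA hA (by
      rw [← ha_def]
      convert hs₀E using 1
      ring)
  rw [← ha_def] at hX hV hE hpath
  have hs₀0 : s₀ ≠ 0 := fun hh => h0 (hh ▸ hs₀)
  set E : Finset (F × F) := {p ∈ X ×ˢ V | p ∈ H} with hEdef
  have hE' : a ^ 2 / (96 * M ^ 2) ≤ #E := by
    convert hE using 1
    ring
  have hEpos : (0 : ℝ) < #E := lt_of_lt_of_le (by positivity) hE'
  have hX' : a / (12 * M) ≤ #X := by
    convert hX using 1
    ring
  have hV' : a / (16 * M) ≤ #V := by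
    convert hV using 1
    ring
  have hXpos : (0 : ℝ) < #X := lt_of_lt_of_le (by positivity) hX'
  have hVpos : (0 : ℝ) < #V := lt_of_lt_of_le (by positivity) hV'
  have hmemG : ∀ s ∈ S, ∀ p ∈ G s, p.1 + s * p.2 ∈ (1 + s) • A := by
    intro s hs p hp
    refine mem_smul_finset.2 ⟨_, (mem_filter.1 hp).2.2, ?_⟩
    rw [smul_eq_mul, mul_div_cancel₀ _ (h1 s hs)]
  have hsum₀ : (#(X + s₀ • V) : ℝ) ≤ 393216 * M ^ 5 * a := by
    have := card_add_smul_mul_le (Λ := (1 + s₀) • A) hs₀0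
      (fun p hp => hmemG s₀ hs₀ p (mem_filter.1 hp).2) hpath
    rw [card_smul_eq (h1 s₀ hs₀), ← ha_def, mul_div_assoc', div_le_iff₀ (by positivity)] at this
    refine le_of_mul_le_mul_right (a := a * a) ?_ (by positivity)
    calc _ ≤ _ := this
      _ = _ := by ring
  -- Parameters whose graph meets a large part of the edges between `X` and `V`; the pivots are
  -- taken among these.
  set S' : Finset F := {s ∈ S | (#E : ℝ) / (4 * M) ≤ #{p ∈ E | p ∈ G s}} with hS'
  have hS'S : S' ⊆ S := filter_subset _ _
  have hS'sum : (#E : ℝ) * n / (4 * M) ≤ ∑ s ∈ S', (#{p ∈ E | p ∈ G s} : ℝ) := by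
    have e1 : (#E : ℝ) * (n / (2 * M)) ≤ ∑ s ∈ S, (#{p ∈ E | p ∈ G s} : ℝ) := by
      rw [swap]
      calc (#E : ℝ) * (n / (2 * M)) = ∑ p ∈ E, n / (2 * M) := by rw [sum_const, nsmul_eq_mul]
        _ ≤ _ := sum_le_sum fun p hp =>
          (mem_filter.1 (mem_filter.1 (mem_filter.1 hp).2).1).2
    have hs := sum_filter_add_sum_filter_not S
      (fun s => (#E : ℝ) / (4 * M) ≤ #{p ∈ E | p ∈ G s}) (fun s => (#{p ∈ E | p ∈ G s} : ℝ))
    have e2 : ∑ s ∈ S with ¬ ((#E : ℝ) / (4 * M) ≤ #{p ∈ E | p ∈ G s}),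
        (#{p ∈ E | p ∈ G s} : ℝ) ≤ n * (#E / (4 * M)) := by
      calc _ ≤ ∑ s ∈ S with ¬ ((#E : ℝ) / (4 * M) ≤ #{p ∈ E | p ∈ G s}), (#E : ℝ) / (4 * M) :=
            sum_le_sum fun p hp => (not_le.1 (mem_filter.1 hp).2).le
        _ ≤ ∑ s ∈ S, (#E : ℝ) / (4 * M) :=
            sum_le_sum_of_subset_of_nonneg (filter_subset _ _) (fun _ _ _ => by positivity)
        _ = #S * ((#E : ℝ) / (4 * M)) := by rw [sum_const, nsmul_eq_mul]
        _ ≤ _ := by gcongr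
    have e3 : (#E : ℝ) * (n / (2 * M)) = #E * n / (4 * M) + n * (#E / (4 * M)) := by
      field_simp; ring
    change _ ≤ ∑ s ∈ S with _, _
    linarith
  set Q : Finset (F × F × F) := {q ∈ S' ×ˢ E | q.2 ∈ G q.1} with hQ
  have hQcard : (#E : ℝ) * n / (4 * M) ≤ #Q := by
    refine hS'sum.trans (le_of_eq ?_)
    simp only [hQ, card_filter, sum_product]
    push_cast
    rfl
  -- With the second coordinate v and the value z = (x + sv)/(1 + s) fixed, x = s(z - v) + z. This
  -- is the affine embedding of the pivots into `X`.
  obtain ⟨⟨z, v⟩, hzv, hzvc⟩ := exists_le_card_fiber_of_nsmul_le_card_of_maps_to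
    (s := Q) (t := A ×ˢ A) (f := fun q => ((q.2.1 + q.1 * q.2.2) / (1 + q.1), q.2.2))
    (b := n / (384 * M ^ 3))
    (fun q hq => by
      have h1 := (mem_filter.1 hq).2
      rw [mem_product]
      exact ⟨(mem_filter.1 h1).2.2, (mem_product.1 (hGA _ h1)).2⟩)
    (hA.product hA)
    (by
      rw [nsmul_eq_mul, card_product]
      push_cast
      rw [← ha_def]
      refine le_trans ?_ hQcard
      calc a * a * (n / (384 * M ^ 3)) = (a ^ 2 / (96 * M ^ 2)) * n / (4 * M) := by
            field_simp; ring
        _ ≤ _ := by gcongr)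
  set Q₁ : Finset (F × F × F) :=
    {q ∈ Q | ((q.2.1 + q.1 * q.2.2) / (1 + q.1), q.2.2) = (z, v)} with hQ₁
  have hQ₁spec : ∀ q ∈ Q₁, q.1 ∈ S' ∧ q.2.1 ∈ X ∧ q.2.1 ≠ v ∧ q.2.2 = v ∧
      q.2.1 = q.1 * (z - v) + z := by
    intro q hq
    obtain ⟨hqQ, hq2⟩ := mem_filter.1 hq
    obtain ⟨hq3, hq4⟩ := mem_filter.1 hqQ
    obtain ⟨hq5, hq6⟩ := mem_product.1 hq3
    rw [Prod.mk.injEq] at hq2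
    have hne := h1 _ (hS'S hq5)
    have hq7 := hq2.1
    rw [div_eq_iff hne, hq2.2] at hq7
    refine ⟨hq5, (mem_product.1 (mem_filter.1 hq6).1).1, ?_, hq2.2, ?_⟩
    · exact fun hh => (mem_filter.1 hq4).2.1 (hh.trans hq2.2.symm)
    · linear_combination hq7
  have hcard : #(Q₁.image Prod.fst) = #Q₁ := by
    apply card_image_of_injOn
    intro q hq q' hq' hqq
    obtain ⟨-, -, -, h2, h3⟩ := hQ₁spec q hq
    obtain ⟨-, -, -, h2', h3'⟩ := hQ₁spec q' hq'
    refine Prod.ext hqq (Prod.ext ?_ ?_)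
    · rw [h3, h3', hqq]
    · rw [h2, h2']
  have hQ₁pos : (0 : ℝ) < #Q₁ := lt_of_lt_of_le (by positivity) hzvc
  -- The condition x ≠ v built into `G` is what makes the embedding non-constant.
  have hzv_ne : z - v ≠ 0 := by
    obtain ⟨q, hq⟩ := card_pos.1 (by exact_mod_cast hQ₁pos : 0 < #Q₁)
    obtain ⟨-, -, h4, h2, h3⟩ := hQ₁spec q hq
    intro h5
    apply h4
    rw [h3, h5, mul_zero, zero_add]
    exact sub_eq_zero.1 h5
  have hTS' : Q₁.image Prod.fst ⊆ S' := by
    intro t ht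
    obtain ⟨q, hq, rfl⟩ := mem_image.1 ht
    exact (hQ₁spec q hq).1
  refine ⟨X, hXA, V, hVA, Q₁.image Prod.fst, hTS'.trans hS'S, s₀, z - v, z, hs₀0, hzv_ne,
    hX', hV', ?_, hsum₀, ?_, ?_⟩
  · rw [hcard]
    exact hzvc
  · intro t ht
    obtain ⟨q, hq, rfl⟩ := mem_image.1 ht
    obtain ⟨-, h5, -, -, h3⟩ := hQ₁spec q hq
    exact h3 ▸ h5
  · intro t ht
    obtain ⟨htS, htE⟩ := mem_filter.1 (hTS' ht)
    have ht0 : t ≠ 0 := fun hh => h0 (hh ▸ htS)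
    -- The sums x + tv along these edges fall in a set of size |A|, so a popular value w supplies a
    -- large W ⊆ V with w - tW ⊆ X.
    obtain ⟨w, hw, hwc⟩ := exists_le_card_fiber_of_nsmul_le_card_of_maps_to
      (s := {p ∈ E | p ∈ G t}) (t := (1 + t) • A) (f := fun p => p.1 + t * p.2)
      (b := a / (384 * M ^ 3))
      (fun p hp => hmemG t htS p (mem_filter.1 hp).2)
      hA.smul_finset
      (by
        rw [nsmul_eq_mul, card_smul_eq (h1 t htS), ← ha_def]
        refine le_trans ?_ htE
        calc a * (a / (384 * M ^ 3)) = (a ^ 2 / (96 * M ^ 2)) / (4 * M) := by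
              field_simp; ring
          _ ≤ _ := by gcongr)
    set W₀ : Finset (F × F) := {p ∈ {p ∈ E | p ∈ G t} | p.1 + t * p.2 = w} with hW₀
    have hWc : #(W₀.image Prod.snd) = #W₀ := by
      apply card_image_of_injOn
      intro p hp p' hp' hpp
      have e1 := (mem_filter.1 hp).2
      have e2 := (mem_filter.1 hp').2
      refine Prod.ext ?_ hpp
      have hpp' : p.2 = p'.2 := hpp
      rw [hpp'] at e1
      linear_combination e1 - e2
    have hWX : ∀ y ∈ W₀.image Prod.snd, y ∈ V ∧ w - t * y ∈ X := by
      intro y hy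
      obtain ⟨p, hp, rfl⟩ := mem_image.1 hy
      obtain ⟨hp1, hp2⟩ := mem_filter.1 hp
      obtain ⟨hp3, hp4⟩ := mem_product.1 (mem_filter.1 (mem_filter.1 hp1).1).1
      refine ⟨hp4, ?_⟩
      rw [← hp2, add_sub_cancel_right]
      exact hp3
    have k1 := card_add_smul_mul_le_of_subset (fun y hy => (hWX y hy).2)
      (fun y hy => (hWX y hy).1) ht0
    rw [hWc] at k1
    have k2 := card_sub_self_mul_le X V s₀ hs₀0
    have k3 := card_sub_self_mul_le' X V s₀ hs₀0
    exact card_add_smul_le_of_le ha hM hX' hV' (hwc) hsum₀ k1 k2 k3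

/-! ### Ratio sets, subfields and expansion. -/

/-- The set of ratios `(a - b) / (c - d)` of differences of elements of `Q`. -/
def ratioSet {F : Type*} [Field F] (Q : Set F) : Set F :=
  {r | ∃ a ∈ Q, ∃ b ∈ Q, ∃ c ∈ Q, ∃ d ∈ Q, c ≠ d ∧ r = (a - b) / (c - d)}

theorem ratioSet_mono {F : Type*} [Field F] {Q Q' : Set F} (h : Q ⊆ Q') :
    ratioSet Q ⊆ ratioSet Q' := by
  rintro r ⟨a, ha, b, hb, c, hc, d, hd, hcd, rfl⟩
  exact ⟨a, h ha, b, h hb, c, h hc, d, h hd, hcd, rfl⟩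

theorem neg_mem_ratioSet {F : Type*} [Field F] {Q : Set F} {r : F} (h : r ∈ ratioSet Q) :
    -r ∈ ratioSet Q := by
  obtain ⟨a, ha, b, hb, c, hc, d, hd, hcd, rfl⟩ := h
  exact ⟨b, hb, a, ha, c, hc, d, hd, hcd, by rw [← neg_div, neg_sub]⟩

theorem inv_mem_ratioSet {F : Type*} [Field F] {Q : Set F} {r : F} (h : r ∈ ratioSet Q) :
    r⁻¹ ∈ ratioSet Q := by
  obtain ⟨a, ha, b, hb, c, hc, d, hd, hcd, rfl⟩ := h
  by_cases hab : a = b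
  · exact ⟨a, ha, b, hb, c, hc, d, hd, hcd, by simp [hab]⟩
  · exact ⟨c, hc, d, hd, a, ha, b, hb, hab, inv_div _ _⟩

/-- If the set of ratios of `insert 0 T` is closed under `r ↦ 1 + r` and under multiplication by
`t / u` for `t ∈ T`, then it is a subfield. -/
theorem exists_subfield_eq_ratioSet {F : Type*} [Field F] [Fintype F] {T : Set F} {u : F}
    (hu : u ∈ T) (hu0 : u ≠ 0)
    (hadd : ∀ r ∈ ratioSet (insert 0 T), 1 + r ∈ ratioSet (insert 0 T))
    (hmul : ∀ r ∈ ratioSet (insert 0 T), ∀ t ∈ T, t / u * r ∈ ratioSet (insert 0 T)) :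
    ∃ G : Subfield F, (G : Set F) = ratioSet (insert 0 T) ∧ ∀ t ∈ T, t / u ∈ G := by
  set R := ratioSet (insert 0 T) with hR
  have h0 : (0 : F) ∈ R :=
    ⟨0, Set.mem_insert _ _, 0, Set.mem_insert _ _, u, Set.mem_insert_of_mem _ hu, 0,
      Set.mem_insert _ _, hu0, by simp⟩
  let P : Submonoid F :=
    { carrier := {p | ∀ r ∈ R, p * r ∈ R}
      one_mem' := fun r hr => by rwa [one_mul]
      mul_mem' := fun {p q} hp hq r hr => by
        rw [mul_assoc]
        exact hp _ (hq _ hr) }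
  let N : AddSubgroup F :=
    { carrier := {p | ∀ r ∈ R, p + r ∈ R}
      zero_mem' := fun r hr => by rwa [zero_add]
      add_mem' := fun {p q} hp hq r hr => by
        rw [add_assoc]
        exact hp _ (hq _ hr)
      neg_mem' := fun {p} hp r hr => by
        have := neg_mem_ratioSet (hp _ (neg_mem_ratioSet hr))
        rwa [neg_add, neg_neg] at this }
  -- For m ≠ 0, m + r = m(1 + m⁻¹r), and m⁻¹r stays in `R` because `R` is closed under inversion.
  -- Thus multiplicative stability gives additive stability.
  have hPN : (P : Set F) ⊆ N := by
    intro m hm r hr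
    by_cases hm0 : m = 0
    · rwa [hm0, zero_add]
    · have h1 : m⁻¹ * r ∈ R := by
        have := inv_mem_ratioSet (hm _ (inv_mem_ratioSet hr))
        rwa [mul_inv, inv_inv] at this
      have h2 := hm _ (hadd _ h1)
      rwa [mul_add, mul_one, mul_inv_cancel_left₀ hm0] at h2
  set D : Set F := (fun t => t / u) '' T with hD
  have hDP : D ⊆ P := by
    rintro _ ⟨t, ht, rfl⟩ r hr
    exact hmul r hr t ht
  -- The subring is the additive span of the monoid generated by `D`, so its elements translate `R`
  -- into itself; apply this to 0 ∈ R.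
  have hcl : ∀ x ∈ Subring.closure D, x ∈ R := by
    intro x hx
    have hxN : x ∈ N := by
      rw [Subring.mem_closure_iff] at hx
      refine (AddSubgroup.closure_le N).2 ?_ hx
      exact Set.Subset.trans (Submonoid.closure_le.2 hDP) hPN
    have := hxN 0 h0
    rwa [add_zero] at this
  -- In a finite field the inverse of a nonzero element is a power of it, so a subring is a
  -- subfield.
  let G : Subfield F :=
    { Subring.closure D with
      inv_mem' := fun x hx => by
        by_cases hx0 : x = 0
        · rw [hx0, inv_zero]
          exact zero_mem (Subring.closure D)
        · have h1 : x ^ (Fintype.card F - 1 - 1) ∈ Subring.closure D := pow_mem hx _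
          have h2 : x⁻¹ = x ^ (Fintype.card F - 1 - 1) := by
            apply inv_eq_of_mul_eq_one_right
            rw [← pow_succ', Nat.sub_add_cancel, FiniteField.pow_card_sub_one_eq_one x hx0]
            have := Fintype.one_lt_card (α := F)
            omega
          rw [h2]
          exact h1 }
  have hGD : ∀ t ∈ T, t / u ∈ G := fun t ht => Subring.subset_closure ⟨t, ht, rfl⟩
  have hGD' : ∀ t ∈ insert 0 T, t / u ∈ G := by
    rintro t (rfl | ht)
    · rw [zero_div]
      exact zero_mem G
    · exact hGD t ht
  refine ⟨G, Set.Subset.antisymm (fun x hx => hcl x hx) ?_, hGD⟩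
  rintro r ⟨a, ha, b, hb, c, hc, d, hd, hcd, rfl⟩
  have := div_mem (sub_mem (hGD' a ha) (hGD' b hb)) (sub_mem (hGD' c hc) (hGD' d hd))
  rwa [← sub_div, ← sub_div, div_div_div_cancel_right₀ hu0] at this

/-- A collision x - ρy = x' - ρy' with y ≠ y' would exhibit ρ as a ratio of differences. -/
theorem card_sq_le_card_sub_smul {F : Type*} [Field F] [DecidableEq F] {T : Finset F} {ρ : F}
    (h : ρ ∉ ratioSet (T : Set F)) : #T ^ 2 ≤ #(T - ρ • T) := by
  rw [sq, ← card_product]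
  refine card_le_card_of_injOn (fun p => p.1 - ρ * p.2) ?_ ?_
  · intro p hp
    have := mem_product.1 hp
    exact sub_mem_sub this.1 (smul_mem_smul_finset (a := ρ) this.2)
  · intro p hp q hq hpq
    have hp' := mem_product.1 hp
    have hq' := mem_product.1 hq
    have hpq' : p.1 - ρ * p.2 = q.1 - ρ * q.2 := hpq
    have h2 : p.2 = q.2 := by
      by_contra hne
      refine h ⟨p.1, hp'.1, q.1, hq'.1, p.2, hp'.2, q.2, hq'.2, hne, ?_⟩
      rw [eq_div_iff (sub_ne_zero.2 hne)]
      linear_combination -hpq'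
    refine Prod.ext ?_ h2
    rw [h2] at hpq'
    linear_combination hpq'

theorem card_sub_smul_le_of_affine {F : Type*} [Field F] [DecidableEq F] {T X : Finset F}
    {c d : F} (hc : c ≠ 0) (hT : ∀ t ∈ T, t * c + d ∈ X) (ρ : F) :
    #(T - ρ • T) ≤ #(X - ρ • X) := by
  refine card_le_card_of_injOn (fun w => w * c + (d - ρ * d)) ?_ ?_
  · intro w hw
    obtain ⟨t, ht, y, hy, rfl⟩ := mem_sub.1 hw
    obtain ⟨t', ht', rfl⟩ := mem_smul_finset.1 hy
    have := sub_mem_sub (hT t ht) (smul_mem_smul_finset (a := ρ) (hT t' ht'))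
    rw [smul_eq_mul] at this
    simp only [smul_eq_mul]
    rw [mem_coe]
    convert this using 1
    ring
  · intro w _ w' _ hww
    simpa [hc] using hww

theorem card_sub_comm {F : Type*} [Field F] [DecidableEq F] (V W : Finset F) :
    #(V - W) = #(W - V) := by
  rw [← card_neg, neg_sub]

/-- Two Ruzsa triangles, through sV and through ρsV, transfer smallness of V - ρV to X - ρX at the
cost of |X + sV|²/|V|². -/
theorem card_sub_smul_mul_sq_le {F : Type*} [Field F] [DecidableEq F] (X V : Finset F) {s ρ : F}
    (hs : s ≠ 0) (hρ : ρ ≠ 0) :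
    #(X - ρ • X) * #V ^ 2 ≤ #(X + s • V) ^ 2 * #(V - ρ • V) := by
  have h1 := ruzsa_triangle_inequality_sub_add_add X (s • V) (ρ • X)
  rw [card_smul_eq hs] at h1
  have h2 := ruzsa_triangle_inequality_add_add_negAdd (ρ • X) (ρ • s • V) (s • V)
  rw [card_smul_eq hρ, card_smul_eq hs, ← smul_add, card_smul_eq hρ, neg_add_eq_sub, smul_comm,
    ← smul_sub_eq, card_smul_eq hs, card_sub_comm] at h2
  calc _ = #(X - ρ • X) * #V * #V := by ring
    _ ≤ #(X + s • V) * #(ρ • X + s • V) * #V := Nat.mul_le_mul_right _ h1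
    _ = #(X + s • V) * (#(ρ • X + s • V) * #V) := by ring
    _ ≤ #(X + s • V) * (#(X + s • V) * #(V - ρ • V)) := Nat.mul_le_mul_left _ h2
    _ = _ := by ring

/-- X + PV is a union of at most four small sets X + qV, so Plünnecke–Ruzsa applies to PV. Four
dilates suffice because a ratio of differences involves four elements. -/
theorem card_nsmul_sub_nsmul_le {F : Type*} [Field F] [DecidableEq F] {X V P : Finset F}
    (hX : X.Nonempty) (hP : #P ≤ 4) {h : ℝ} (hh : 0 ≤ h)
    (hXV : ∀ q ∈ P, (#(X + q • V) : ℝ) ≤ h) (m n : ℕ) :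
    (#(m • (P * V) - n • (P * V)) : ℝ) ≤ (4 * h / #X) ^ (m + n) * #X := by
  have h1 := pluennecke_ruzsa_inequality_nsmul_sub_nsmul_add hX (P * V) m n
  have h1' : (#(m • (P * V) - n • (P * V)) : ℝ) ≤ (#(X + P * V) / #X) ^ (m + n) * #X := by
    have := NNRat.cast_mono (K := ℝ) h1
    push_cast at this
    exact this
  refine h1'.trans ?_
  have h2 : X + P * V ⊆ P.biUnion fun q => X + q • V := by
    intro w hw
    obtain ⟨x, hx, y, hy, rfl⟩ := mem_add.1 hw
    obtain ⟨q, hq, v, hv, rfl⟩ := mem_mul.1 hy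
    exact mem_biUnion.2 ⟨q, hq, add_mem_add hx (smul_mem_smul_finset hv)⟩
  have h3 : (#(X + P * V) : ℝ) ≤ 4 * h :=
    calc (#(X + P * V) : ℝ) ≤ ∑ q ∈ P, (#(X + q • V) : ℝ) := by
          exact_mod_cast (card_le_card h2).trans card_biUnion_le
      _ ≤ ∑ q ∈ P, h := sum_le_sum hXV
      _ = #P * h := by rw [sum_const, nsmul_eq_mul]
      _ ≤ 4 * h := by
          gcongr
          exact_mod_cast hP
  gcongr

/-- Clearing the denominator of r = (a - b)/(c - d) places the dilate of V - rV by c - d in 2PV -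
2PV, with P = {a, b, c, d}. For 1 + r one more summand is needed on each side. -/
theorem card_sub_smul_le_of_mem_ratioSet {F : Type*} [Field F] [DecidableEq F]
    {X V Q : Finset F} (hX : X.Nonempty) {h : ℝ} (hh : 0 ≤ h)
    (hXV : ∀ q ∈ Q, (#(X + q • V) : ℝ) ≤ h) {r : F} (hr : r ∈ ratioSet (Q : Set F)) :
    (#(V - r • V) : ℝ) ≤ (4 * h / #X) ^ 4 * #X ∧
      (#(V - (1 + r) • V) : ℝ) ≤ (4 * h / #X) ^ 6 * #X := by
  obtain ⟨a, ha, b, hb, c, hc, d, hd, hcd, rfl⟩ := hr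
  have hcd' := sub_ne_zero.2 hcd
  have hPQ : ∀ q ∈ ({a, b, c, d} : Finset F), (#(X + q • V) : ℝ) ≤ h := by
    intro q hq
    apply hXV
    simp only [mem_insert, mem_singleton] at hq
    rcases hq with rfl | rfl | rfl | rfl <;> assumption
  have hm : ∀ q ∈ ({a, b, c, d} : Finset F), ∀ v ∈ V, q * v ∈ ({a, b, c, d} : Finset F) * V :=
    fun q hq v hv => mul_mem_mul hq hv
  constructor
  · refine le_trans ?_ (card_nsmul_sub_nsmul_le hX card_le_four hh hPQ 2 2)
    norm_cast
    rw [← card_smul_eq hcd']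
    apply card_le_card
    intro w hw
    obtain ⟨_, hy, rfl⟩ := mem_smul_finset.1 hw
    obtain ⟨v, hv, y, hy', rfl⟩ := mem_sub.1 hy
    obtain ⟨v', hv', rfl⟩ := mem_smul_finset.1 hy'
    rw [two_nsmul]
    refine mem_sub.2 ⟨c * v + b * v', add_mem_add (hm _ (by simp) _ hv) (hm _ (by simp) _ hv'),
      d * v + a * v', add_mem_add (hm _ (by simp) _ hv) (hm _ (by simp) _ hv'), ?_⟩
    simp only [smul_eq_mul]
    field_simp
    ring
  · refine le_trans ?_ (card_nsmul_sub_nsmul_le hX card_le_four hh hPQ 3 3)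
    norm_cast
    rw [← card_smul_eq hcd']
    apply card_le_card
    intro w hw
    obtain ⟨_, hy, rfl⟩ := mem_smul_finset.1 hw
    obtain ⟨v, hv, y, hy', rfl⟩ := mem_sub.1 hy
    obtain ⟨v', hv', rfl⟩ := mem_smul_finset.1 hy'
    rw [succ_nsmul, two_nsmul]
    refine mem_sub.2 ⟨c * v + b * v' + d * v', add_mem_add (add_mem_add (hm _ (by simp) _ hv)
        (hm _ (by simp) _ hv')) (hm _ (by simp) _ hv'),
      d * v + a * v' + c * v', add_mem_add (add_mem_add (hm _ (by simp) _ hv)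
        (hm _ (by simp) _ hv')) (hm _ (by simp) _ hv'), ?_⟩
    simp only [smul_eq_mul]
    field_simp
    ring

/-- A Ruzsa triangle through (t/u)V reduces to V - (t/u)V, a dilate of uV - tV, which is controlled
through X. -/
theorem card_sub_div_mul_smul_le {F : Type*} [Field F] [DecidableEq F] (X V : Finset F)
    {t u : F} (ht : t ≠ 0) (hu : u ≠ 0) (r : F) :
    #(V - (t / u * r) • V) * (#V * #X) ≤
      #(X + u • V) * #(X + t • V) * #(V - r • V) := by
  have htu : t / u ≠ 0 := div_ne_zero ht hu
  have h1 := ruzsa_triangle_inequality_sub_sub_sub V ((t / u) • V) ((t / u * r) • V)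
  rw [card_smul_eq htu, mul_smul, ← smul_sub_eq, card_smul_eq htu,
    card_sub_comm (r • V)] at h1
  have h2 := ruzsa_triangle_inequality_sub_add_add (u • V) X (t • V)
  have h3 : #(V - (t / u) • V) = #(u • V - t • V) := by
    rw [← card_smul_eq hu, smul_sub_eq, smul_smul, mul_div_cancel₀ _ hu]
  rw [← h3, add_comm _ X, add_comm _ X] at h2
  rw [mul_smul]
  calc _ = #(V - (t / u) • r • V) * #V * #X := by ring
    _ ≤ #(V - (t / u) • V) * #(V - r • V) * #X := Nat.mul_le_mul_right _ h1
    _ = #(V - (t / u) • V) * #X * #(V - r • V) := by ring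
    _ ≤ _ := Nat.mul_le_mul_right _ h2

/-- Either the pivots `T` lie in a dilate of a subfield `G` such that all `V - r V` with `r ∈ G`
are small, or `T` itself is small. -/
theorem exists_subfield_or_card_le {F : Type*} [Field F] [Fintype F] [DecidableEq F]
    {X V T : Finset F} {s c d : F} {h : ℝ} (hX : X.Nonempty) (hT : T.Nonempty) (h0 : 0 ∉ T)
    (hs : s ≠ 0) (hc : c ≠ 0) (hTX : ∀ t ∈ T, t * c + d ∈ X) (hXh : (#X : ℝ) ≤ h)
    (hV : V.Nonempty)
    (hXV : ∀ t ∈ T, (#(X + t • V) : ℝ) ≤ h) :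
    (∃ (G : Subfield F) (u : F), u ≠ 0 ∧ (∀ t ∈ T, t / u ∈ G) ∧
      ∀ r ∈ G, (#(V - r • V) : ℝ) ≤ (4 * h / #X) ^ 4 * #X) ∨
    (#T : ℝ) ^ 2 * #V ^ 2 ≤ #(X + s • V) ^ 2 * ((4 * h / #X) ^ 6 * #X) ∨
    (#T : ℝ) ^ 2 * #V ^ 2 * (#V * #X) ≤
      #(X + s • V) ^ 2 * (h * h * ((4 * h / #X) ^ 4 * #X)) := by
  obtain ⟨u, hu⟩ := hT
  have hne : ∀ t ∈ T, t ≠ 0 := fun t ht hh => h0 (hh ▸ ht)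
  have hh : 0 ≤ h := le_trans (by positivity) hXh
  -- Adjoining 0 keeps the ratio set nonempty even for a single pivot, and is harmless since X + 0·V
  -- = X.
  have hQ : ∀ q ∈ insert 0 T, (#(X + q • V) : ℝ) ≤ h := by
    intro q hq
    rcases mem_insert.1 hq with rfl | hq
    · rwa [zero_smul_finset hV, add_zero]
    · exact hXV q hq
  have hcoe : ((insert 0 T : Finset F) : Set F) = insert 0 (T : Set F) := coe_insert _ _
  have hsub : ratioSet (T : Set F) ⊆ ratioSet (insert 0 (T : Set F)) :=
    ratioSet_mono (Set.subset_insert _ _)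
  have hsmall : ∀ ρ ∉ ratioSet (insert 0 (T : Set F)),
      (#T : ℝ) ^ 2 * #V ^ 2 ≤ #(X + s • V) ^ 2 * #(V - ρ • V) := by
    intro ρ hρ
    have hρ0 : ρ ≠ 0 := by
      rintro rfl
      exact hρ ⟨0, by simp, 0, by simp, u, by simp [hu], 0, by simp, hne u hu, by simp⟩
    have h1 := (card_sq_le_card_sub_smul fun hh => hρ (hsub hh)).trans
      (card_sub_smul_le_of_affine hc hTX ρ)
    have h2 := card_sub_smul_mul_sq_le X V hs hρ0
    exact_mod_cast (Nat.mul_le_mul_right _ h1).trans h2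
  by_cases hadd : ∀ r ∈ ratioSet (insert 0 (T : Set F)), 1 + r ∈ ratioSet (insert 0 (T : Set F))
  · by_cases hmul : ∀ r ∈ ratioSet (insert 0 (T : Set F)), ∀ t ∈ (T : Set F),
        t / u * r ∈ ratioSet (insert 0 (T : Set F))
    · left
      obtain ⟨G, hG, hGT⟩ := exists_subfield_eq_ratioSet (mem_coe.2 hu) (hne u hu) hadd hmul
      refine ⟨G, u, hne u hu, hGT, fun r hr => ?_⟩
      refine (card_sub_smul_le_of_mem_ratioSet hX hh hQ ?_).1
      rw [hcoe, ← hG]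
      exact hr
    · push Not at hmul
      obtain ⟨r, hr, t, ht, hrt⟩ := hmul
      right; right
      have h1 := hsmall _ hrt
      have h2 := card_sub_div_mul_smul_le X V (hne t ht) (hne u hu) r
      have h2' : (#(V - (t / u * r) • V) : ℝ) * (#V * #X) ≤
        #(X + u • V) * #(X + t • V) * #(V - r • V) := by exact_mod_cast h2
      have h3 := (card_sub_smul_le_of_mem_ratioSet hX hh hQ (hcoe ▸ hr)).1
      calc (#T : ℝ) ^ 2 * #V ^ 2 * (#V * #X)
          ≤ (#(X + s • V) : ℝ) ^ 2 * #(V - (t / u * r) • V) * (#V * #X) := by gcongr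
        _ = (#(X + s • V) : ℝ) ^ 2 * (#(V - (t / u * r) • V) * (#V * #X)) := mul_assoc _ _ _
        _ ≤ (#(X + s • V) : ℝ) ^ 2 * (#(X + u • V) * #(X + t • V) * #(V - r • V)) := by gcongr
        _ ≤ _ := by
            gcongr
            · exact hXV u hu
            · exact hXV t ht
  · push Not at hadd
    obtain ⟨r, hr, hr1⟩ := hadd
    right; left
    refine (hsmall _ hr1).trans ?_
    have h3 := (card_sub_smul_le_of_mem_ratioSet hX hh hQ (hcoe ▸ hr)).2
    gcongr

/-! ### Averaging energies over dilates. -/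

theorem card_sq_le_card_mul_card_collisions {ι κ : Type*} [DecidableEq κ] (s : Finset ι)
    (t : Finset κ) (f : ι → κ) (hf : ∀ x ∈ s, f x ∈ t) :
    #s ^ 2 ≤ #t * #{p ∈ s ×ˢ s | f p.1 = f p.2} := by
  have h1 : #{p ∈ s ×ˢ s | f p.1 = f p.2} = ∑ y ∈ t, #{x ∈ s | f x = y} ^ 2 := by
    rw [card_eq_sum_card_fiberwise (f := fun p => f p.1) (t := t)
      (fun p hp => hf _ (mem_product.1 (mem_filter.1 hp).1).1)]
    refine sum_congr rfl fun y _ => ?_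
    rw [sq, ← card_product]
    congr 1
    ext p
    simp only [mem_filter, mem_product]
    constructor
    · rintro ⟨⟨⟨h1, h2⟩, h3⟩, h4⟩
      exact ⟨⟨h1, h4⟩, h2, h3 ▸ h4⟩
    · rintro ⟨⟨h1, h2⟩, h3, h4⟩
      exact ⟨⟨⟨h1, h3⟩, h2.trans h4.symm⟩, h2⟩
  rw [h1, card_eq_sum_card_fiberwise (f := f) (t := t) hf]
  exact sq_sum_le_card_mul_sum_sq

/-- Some dilate `r` in a given set `G` makes `V - r V` large. -/
theorem exists_min_le_card_sub_smul {F : Type*} [Field F] [DecidableEq F] (V G : Finset F)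
    (hV : V.Nonempty) (hG : G.Nonempty) :
    ∃ r ∈ G, min (#V ^ 2) #G ≤ 2 * #(V - r • V) := by
  set E : F → ℕ := fun r =>
    #{p ∈ (V ×ˢ V) ×ˢ (V ×ˢ V) | p.1.1 - r * p.1.2 = p.2.1 - r * p.2.2} with hE
  -- A diagonal quadruple counts for every r, while any other one determines r.
  have hsum : ∑ r ∈ G, E r ≤ #G * #V ^ 2 + #V ^ 4 := by
    have e1 : ∑ r ∈ G, E r =
        ∑ p ∈ (V ×ˢ V) ×ˢ (V ×ˢ V), #{r ∈ G | p.1.1 - r * p.1.2 = p.2.1 - r * p.2.2} := by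
      simp only [hE, card_filter]
      exact sum_comm
    rw [e1]
    calc _ ≤ ∑ p ∈ (V ×ˢ V) ×ˢ (V ×ˢ V), ((if p.1 = p.2 then #G else 0) + 1) := by
          refine sum_le_sum fun p _ => ?_
          split_ifs with hp
          · exact (card_le_card (filter_subset _ _)).trans (Nat.le_succ _)
          · rw [zero_add, card_le_one]
            intro r hr r' hr'
            have e2 := (mem_filter.1 hr).2
            have e3 := (mem_filter.1 hr').2
            have e4 : (r - r') * (p.1.2 - p.2.2) = 0 := by linear_combination e3 - e2
            rcases mul_eq_zero.1 e4 with e5 | e5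
            · exact sub_eq_zero.1 e5
            · exfalso
              apply hp
              have e6 := sub_eq_zero.1 e5
              rw [e6] at e2
              exact Prod.ext (by linear_combination e2) e6
      _ = #G * #V ^ 2 + #V ^ 4 := by
          rw [sum_add_distrib, ← sum_filter, sum_const, smul_eq_mul, sum_const, smul_eq_mul]
          have : #{p ∈ (V ×ˢ V) ×ˢ (V ×ˢ V) | p.1 = p.2} = #V ^ 2 := by
            have e : {p ∈ (V ×ˢ V) ×ˢ (V ×ˢ V) | p.1 = p.2} = (V ×ˢ V).diag := by
              ext p
              simp only [mem_filter, mem_product, mem_diag]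
              grind
            rw [e, diag_card, card_product, sq]
          rw [this]
          simp only [card_product]
          ring
  obtain ⟨r, hr, hrE⟩ : ∃ r ∈ G, #G * E r ≤ #G * #V ^ 2 + #V ^ 4 := by
    by_contra! hcon
    have h1 : ∑ r ∈ G, (#G * #V ^ 2 + #V ^ 4) < ∑ r ∈ G, #G * E r := sum_lt_sum_of_nonempty hG hcon
    rw [sum_const, smul_eq_mul, ← mul_sum] at h1
    exact absurd (Nat.mul_le_mul_left _ hsum) (not_le.2 h1)
  refine ⟨r, hr, ?_⟩
  have hcs := card_sq_le_card_mul_card_collisions (V ×ˢ V) (V - r • V) (fun p => p.1 - r * p.2)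
    (fun p hp => sub_mem_sub (mem_product.1 hp).1
      (smul_mem_smul_finset (a := r) (mem_product.1 hp).2))
  change _ ≤ _ * E r at hcs
  rw [card_product] at hcs
  have hv := hV.card_pos
  have hg := hG.card_pos
  rcases le_total (#V ^ 2) #G with hle | hle
  · rw [min_eq_left hle]
    have e1 : E r ≤ 2 * #V ^ 2 := by
      apply Nat.le_of_mul_le_mul_left _ hg
      nlinarith
    have e2 : #V ^ 2 * #V ^ 2 ≤ (2 * #(V - r • V)) * #V ^ 2 := by nlinarith
    exact Nat.le_of_mul_le_mul_right e2 (by positivity)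
  · rw [min_eq_right hle]
    have e1 : #G * E r ≤ 2 * #V ^ 4 := by nlinarith
    have e2 : #G * #V ^ 4 ≤ (2 * #(V - r • V)) * #V ^ 4 := by
      calc #G * #V ^ 4 = #G * (#V * #V) ^ 2 := by ring
        _ ≤ #G * (#(V - r • V) * E r) := Nat.mul_le_mul_left _ hcs
        _ = #(V - r • V) * (#G * E r) := by ring
        _ ≤ #(V - r • V) * (2 * #V ^ 4) := Nat.mul_le_mul_left _ e1
        _ = _ := by ring
    exact Nat.le_of_mul_le_mul_right e2 (by positivity)

/-! ### From collinear triples to the pivot configuration. -/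

/-- Collinear triples of `A × B` at three distinct heights, on non-vertical lines. -/
def properTriples {F : Type*} [Field F] [DecidableEq F] (A B : Finset F) :
    Finset ((F × F × F) × F × F × F) :=
  {x ∈ (A ×ˢ A ×ˢ A) ×ˢ (B ×ˢ B ×ˢ B) |
    (x.1.2.1 - x.1.1) * (x.2.2.2 - x.2.1) = (x.1.2.2 - x.1.1) * (x.2.2.1 - x.2.1) ∧
    x.1.1 ≠ x.1.2.1 ∧ x.2.1 ≠ x.2.2.1 ∧ x.2.1 ≠ x.2.2.2 ∧ x.2.2.1 ≠ x.2.2.2}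

theorem card_properTriples_le {F : Type*} [Field F] [DecidableEq F] (A B : Finset F) :
    #(properTriples A B) ≤ #A ^ 2 * #B ^ 3 := by
  have : #((A ×ˢ A) ×ˢ (B ×ˢ B ×ˢ B)) = #A ^ 2 * #B ^ 3 := by
    simp only [card_product]
    ring
  rw [← this]
  refine card_le_card_of_injOn (fun x => ((x.1.1, x.1.2.1), x.2)) ?_ ?_
  · intro x hx
    have := (mem_filter.1 hx).1
    simp only [coe_product, Set.mem_prod, mem_coe, mem_product] at this ⊢
    tauto
  · rintro ⟨⟨a, b, c⟩, d, e, f⟩ hx ⟨⟨a', b', c'⟩, d', e', f'⟩ hx' hxx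
    obtain ⟨-, h1, -, h2, -⟩ := mem_filter.1 hx
    obtain ⟨-, h1', -⟩ := mem_filter.1 hx'
    simp only [Prod.mk.injEq] at hxx h1 h1' h2 ⊢
    obtain ⟨⟨rfl, rfl⟩, rfl, rfl, rfl⟩ := hxx
    refine ⟨⟨rfl, rfl, ?_⟩, rfl, rfl, rfl⟩
    have : (c - c') * (e - d) = 0 := by linear_combination h1' - h1
    rcases mul_eq_zero.1 this with h | h
    · exact sub_eq_zero.1 h
    · exact absurd (sub_eq_zero.1 h).symm h2

/-- Degenerate triples: horizontal ones give |A|³|B|. Each of the three kinds with two coinciding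
points gives |A|²|B|², and vertical ones give |A||B|³ ≤ |A|²|B|². -/
theorem collinearTriples_le {F : Type*} [Field F] [DecidableEq F] (A B : Finset F)
    (hBA : #B ≤ #A) :
    collinearTriples A B ≤ #(properTriples A B) + #A ^ 3 * #B + 4 * (#A ^ 2 * #B ^ 2) := by
  classical
  set D₁ : Finset ((F × F × F) × F × F × F) :=
    ((A ×ˢ A ×ˢ A) ×ˢ B).image (fun y => (y.1, y.2, y.2, y.2)) with hD₁
  set D₂ : Finset ((F × F × F) × F × F × F) :=
    ((A ×ˢ A) ×ˢ (B ×ˢ B)).image (fun y => ((y.1.1, y.1.1, y.1.2), y.2.1, y.2.1, y.2.2)) with hD₂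
  set D₃ : Finset ((F × F × F) × F × F × F) :=
    ((A ×ˢ A) ×ˢ (B ×ˢ B)).image (fun y => ((y.1.1, y.1.2, y.1.1), y.2.1, y.2.2, y.2.1)) with hD₃
  set D₄ : Finset ((F × F × F) × F × F × F) :=
    ((A ×ˢ A) ×ˢ (B ×ˢ B)).image (fun y => ((y.1.1, y.1.2, y.1.2), y.2.1, y.2.2, y.2.2)) with hD₄
  set D₅ : Finset ((F × F × F) × F × F × F) :=
    (A ×ˢ (B ×ˢ B ×ˢ B)).image (fun y => ((y.1, y.1, y.1), y.2)) with hD₅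
  have hsub : ((A ×ˢ A ×ˢ A) ×ˢ (B ×ˢ B ×ˢ B)).filter (fun x =>
      (x.1.2.1 - x.1.1) * (x.2.2.2 - x.2.1) = (x.1.2.2 - x.1.1) * (x.2.2.1 - x.2.1)) ⊆
      properTriples A B ∪ (D₁ ∪ (D₂ ∪ (D₃ ∪ (D₄ ∪ D₅)))) := by
    rintro ⟨⟨a, b, c⟩, d, e, f⟩ hx
    obtain ⟨hm, heq⟩ := mem_filter.1 hx
    simp only [mem_product] at hm heq
    simp only [mem_union]
    by_cases hde : d = e
    · subst hde
      by_cases hdf : d = f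
      · subst hdf
        right; left
        exact mem_image.2 ⟨((a, b, c), d), by simp [hm], rfl⟩
      · right; right; left
        have : b = a := by
          rw [sub_self, mul_zero] at heq
          rcases mul_eq_zero.1 heq with h | h
          · exact sub_eq_zero.1 h
          · exact absurd (sub_eq_zero.1 h).symm hdf
        subst this
        exact mem_image.2 ⟨((b, c), (d, f)), by simp [hm], rfl⟩
    · by_cases hdf : d = f
      · subst hdf
        right; right; right; left
        have : c = a := by
          rw [sub_self, mul_zero] at heq
          rcases mul_eq_zero.1 heq.symm with h | h
          · exact sub_eq_zero.1 h
          · exact absurd (sub_eq_zero.1 h).symm hde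
        subst this
        exact mem_image.2 ⟨((c, b), (d, e)), by simp [hm], rfl⟩
      · by_cases hef : e = f
        · subst hef
          right; right; right; right; left
          have : b = c := by
            have h0 : (b - c) * (e - d) = 0 := by linear_combination heq
            rcases mul_eq_zero.1 h0 with h | h
            · exact sub_eq_zero.1 h
            · exact absurd (sub_eq_zero.1 h).symm hde
          subst this
          exact mem_image.2 ⟨((a, b), (d, e)), by simp [hm], rfl⟩
        · by_cases hab : a = b
          · subst hab
            right; right; right; right; right
            have : c = a := by
              rw [sub_self, zero_mul] at heq
              rcases mul_eq_zero.1 heq.symm with h | h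
              · exact sub_eq_zero.1 h
              · exact absurd (sub_eq_zero.1 h).symm hde
            subst this
            exact mem_image.2 ⟨(c, (d, e, f)), by simp [hm], rfl⟩
          · left
            exact mem_filter.2 ⟨by simp [hm], heq, hab, hde, hdf, hef⟩
  have h1 : #D₁ ≤ #A ^ 3 * #B := card_image_le.trans (by simp only [card_product]; ring_nf; rfl)
  have h2 : #D₂ ≤ #A ^ 2 * #B ^ 2 :=
    card_image_le.trans (by simp only [card_product]; ring_nf; rfl)
  have h3 : #D₃ ≤ #A ^ 2 * #B ^ 2 :=
    card_image_le.trans (by simp only [card_product]; ring_nf; rfl)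
  have h4 : #D₄ ≤ #A ^ 2 * #B ^ 2 :=
    card_image_le.trans (by simp only [card_product]; ring_nf; rfl)
  have h5 : #D₅ ≤ #A ^ 2 * #B ^ 2 := by
    refine card_image_le.trans ?_
    simp only [card_product]
    calc #A * (#B * (#B * #B)) = #B * (#A * #B ^ 2) := by ring
      _ ≤ #A * (#A * #B ^ 2) := Nat.mul_le_mul_right _ hBA
      _ = _ := by ring
  have h6 : collinearTriples A B ≤ #(properTriples A B ∪ (D₁ ∪ (D₂ ∪ (D₃ ∪ (D₄ ∪ D₅))))) := by
    refine le_trans (le_of_eq ?_) (card_le_card hsub)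
    unfold collinearTriples
    congr
  have u1 := card_union_le (properTriples A B) (D₁ ∪ (D₂ ∪ (D₃ ∪ (D₄ ∪ D₅))))
  have u2 := card_union_le D₁ (D₂ ∪ (D₃ ∪ (D₄ ∪ D₅)))
  have u3 := card_union_le D₂ (D₃ ∪ (D₄ ∪ D₅))
  have u4 := card_union_le D₃ (D₄ ∪ D₅)
  have u5 := card_union_le D₄ D₅
  omega

/-- Many collinear triples lead to the configuration of `exists_subsets_card_add_smul_le`. -/
theorem exists_subsets_of_properTriples {F : Type*} [Field F] [DecidableEq F] (A B : Finset F)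
    (hA : A.Nonempty) (hB : B.Nonempty) (M : ℝ) (hM : 0 < M)
    (h : (#A : ℝ) ^ 2 * #B ^ 3 / M ≤ #(properTriples A B)) :
    ∃ X ⊆ A, ∃ V ⊆ A, ∃ T : Finset F, ∃ s c d : F, 0 ∉ T ∧ s ≠ 0 ∧ c ≠ 0 ∧
      (#A : ℝ) / (12 * M) ≤ #X ∧ (#A : ℝ) / (16 * M) ≤ #V ∧ #B / (384 * M ^ 3) ≤ (#T : ℝ) ∧
      (#(X + s • V) : ℝ) ≤ 393216 * M ^ 5 * #A ∧ (∀ t ∈ T, t * c + d ∈ X) ∧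
      ∀ t ∈ T, (#(X + t • V) : ℝ) ≤ 73728 * 393216 ^ 4 * M ^ 25 * #A := by
  have ha : (0 : ℝ) < #A := by exact_mod_cast hA.card_pos
  have hb : (0 : ℝ) < #B := by exact_mod_cast hB.card_pos
  obtain ⟨⟨b₁, b₂⟩, hb₁₂, hcard⟩ := exists_le_card_fiber_of_nsmul_le_card_of_maps_to
    (s := properTriples A B) (t := B ×ˢ B) (f := fun x => (x.2.1, x.2.2.1))
    (b := (#A : ℝ) ^ 2 * #B / M)
    (fun x hx => by
      have := (mem_filter.1 hx).1
      simp only [mem_product] at this ⊢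
      tauto)
    (hB.product hB)
    (by
      rw [nsmul_eq_mul, card_product]
      push_cast
      refine le_trans (le_of_eq ?_) h
      ring)
  set Q : Finset ((F × F × F) × F × F × F) :=
    {x ∈ properTriples A B | (x.2.1, x.2.2.1) = (b₁, b₂)} with hQ
  have hQpos : (0 : ℝ) < #Q := lt_of_lt_of_le (by positivity) hcard
  have hspec : ∀ x ∈ Q, (x.1.1 ∈ A ∧ x.1.2.1 ∈ A ∧ x.1.2.2 ∈ A) ∧
      (x.2.2.2 ∈ B ∧ x.2.1 = b₁ ∧ x.2.2.1 = b₂ ∧ b₁ ≠ b₂ ∧ b₁ ≠ x.2.2.2 ∧ b₂ ≠ x.2.2.2) ∧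
      x.1.1 ≠ x.1.2.1 ∧ (x.1.2.1 - x.1.1) * (x.2.2.2 - b₁) = (x.1.2.2 - x.1.1) * (b₂ - b₁) := by
    intro x hx
    obtain ⟨hx1, hx2⟩ := mem_filter.1 hx
    obtain ⟨hx3, hx4, hx5, hx6, hx7, hx8⟩ := mem_filter.1 hx1
    simp only [mem_product] at hx3
    rw [Prod.mk.injEq] at hx2
    obtain ⟨e1, e2⟩ := hx2
    rw [e1, e2] at hx4 hx6
    rw [e1] at hx7
    rw [e2] at hx8
    exact ⟨hx3.1, ⟨hx3.2.2.2, e1, e2, hx6, hx7, hx8⟩, hx5, hx4⟩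
  have hbne : b₁ ≠ b₂ := by
    obtain ⟨x, hx⟩ := card_pos.1 (by exact_mod_cast hQpos : 0 < #Q)
    exact (hspec x hx).2.1.2.2.2.1
  have hbne' : b₂ - b₁ ≠ 0 := sub_ne_zero.2 hbne.symm
  -- On the line through (x, b₁) and (y, b₂), the point at height b has abscissa (x + φ(b) y)/(1 +
  -- φ(b)).
  set φ : F → F := fun b => (b - b₁) / (b₂ - b) with hφ
  have hφ1 : ∀ b, b₂ ≠ b → 1 + φ b = (b₂ - b₁) / (b₂ - b) := by
    intro b hb
    have := sub_ne_zero.2 hb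
    simp only [hφ]
    field_simp
    ring
  set S : Finset F := (B.filter fun b => b₁ ≠ b ∧ b₂ ≠ b).image φ with hS
  have hφS : ∀ s ∈ S, ∃ b ∈ B, b₁ ≠ b ∧ b₂ ≠ b ∧ φ b = s := by
    intro s hs
    obtain ⟨b, hb, rfl⟩ := mem_image.1 hs
    obtain ⟨h1, h2, h3⟩ := mem_filter.1 hb
    exact ⟨b, h1, h2, h3, rfl⟩
  have h0S : (0 : F) ∉ S := by
    intro h0
    obtain ⟨b, -, h1, h2, h3⟩ := hφS 0 h0
    exact div_ne_zero (sub_ne_zero.2 h1.symm) (sub_ne_zero.2 h2) h3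
  have h1S : ∀ s ∈ S, 1 + s ≠ 0 := by
    intro s hs
    obtain ⟨b, -, h1, h2, rfl⟩ := hφS s hs
    rw [hφ1 b h2]
    exact div_ne_zero hbne' (sub_ne_zero.2 h2)
  have hSn : (#S : ℝ) ≤ #B := by
    exact_mod_cast card_image_le.trans (card_le_card (filter_subset _ _))
  have hsum : (#A : ℝ) ^ 2 * #B / M ≤
      ∑ s ∈ S, (#{p ∈ A ×ˢ A | p.1 ≠ p.2 ∧ (p.1 + s * p.2) / (1 + s) ∈ A} : ℝ) := by
    refine hcard.trans ?_
    have e : ∑ s ∈ S, #{p ∈ A ×ˢ A | p.1 ≠ p.2 ∧ (p.1 + s * p.2) / (1 + s) ∈ A} =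
        #{q ∈ S ×ˢ (A ×ˢ A) | q.2.1 ≠ q.2.2 ∧ (q.2.1 + q.1 * q.2.2) / (1 + q.1) ∈ A} := by
      simp only [card_filter, sum_product S]
    rw [← Nat.cast_sum, e]
    norm_cast
    have hz : ∀ x ∈ Q, (x.1.1 + φ x.2.2.2 * x.1.2.1) / (1 + φ x.2.2.2) = x.1.2.2 := by
      intro x hx
      obtain ⟨-, ⟨-, -, -, -, -, h2⟩, -, h3⟩ := hspec x hx
      have h4 := sub_ne_zero.2 h2
      rw [hφ1 _ h2]
      simp only [hφ]
      rw [div_eq_iff (div_ne_zero hbne' h4)]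
      field_simp
      linear_combination h3
    refine card_le_card_of_injOn (fun x => (φ x.2.2.2, (x.1.1, x.1.2.1))) ?_ ?_
    · intro x hx
      obtain ⟨⟨m1, m2, m3⟩, ⟨m4, -, -, -, h1, h2⟩, h3, -⟩ := hspec x hx
      refine mem_filter.2 ⟨mem_product.2 ⟨mem_image.2 ⟨x.2.2.2, mem_filter.2 ⟨m4, h1, h2⟩, rfl⟩,
        mem_product.2 ⟨m1, m2⟩⟩, h3, ?_⟩
      rw [hz x hx]
      exact m3
    · intro x hx y hy hxy
      have hzx := hz x hx
      have hzy := hz y hy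
      obtain ⟨-, ⟨-, e1, e2, -, -, h2⟩, -, -⟩ := hspec x hx
      obtain ⟨-, ⟨-, e1', e2', -, -, h2'⟩, -, -⟩ := hspec y hy
      simp only [Prod.mk.injEq] at hxy
      obtain ⟨f1, f2, f3⟩ := hxy
      have f4 : x.2.2.2 = y.2.2.2 := by
        have g1 : 1 + φ x.2.2.2 = 1 + φ y.2.2.2 := by rw [f1]
        rw [hφ1 _ h2, hφ1 _ h2', div_eq_div_iff (sub_ne_zero.2 h2) (sub_ne_zero.2 h2')] at g1
        linear_combination mul_left_cancel₀ hbne' g1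
      rw [f1, f2, f3, hzy] at hzx
      exact Prod.ext (Prod.ext f2 (Prod.ext f3 hzx.symm))
        (Prod.ext (e1.trans e1'.symm) (Prod.ext (e2.trans e2'.symm) f4))
  obtain ⟨X, hX, V, hV, T, hT, s, c, d, h1, h2, h3⟩ :=
    exists_subsets_card_add_smul_le A S #B M hM hb hSn hA h0S h1S hsum
  exact ⟨X, hX, V, hV, T, s, c, d, fun hh => h0S (hT hh), h1, h2, h3⟩

/-! ### Quantitative alternatives and the bound on collinear triples. -/

/-- If `A × B` has at least `|A|² |B|³ / M` proper collinear triples, then `M` is large in terms of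
the sizes of `A`, `B` and `F`, or `A` is concentrated on an affine image of a subfield. -/
theorem bounds_of_properTriples :
    ∃ C : ℝ, 1 ≤ C ∧ ∀ {F : Type*} [Field F] [Fintype F] [DecidableEq F] (A B : Finset F)
      (_ : A.Nonempty) (_ : B.Nonempty) (K D M : ℝ) (_ : 0 ≤ K) (_ : 1 ≤ M)
      (_ : ∀ G : Subfield F, G ≠ ⊤ → ∀ c d : F,
        (((A : Set F) ∩ ((fun g : F => c * g + d) '' (G : Set F))).ncard : ℝ) ≤
          K * max ((Nat.card G : ℝ) ^ ((1 : ℝ) / 2)) D)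
      (_ : (#A : ℝ) ^ 2 * #B ^ 3 / M ≤ #(properTriples A B)),
      (#B : ℝ) ^ 2 ≤ C * M ^ 173 * #A ∨ (#A : ℝ) ≤ C * M ^ 105 ∨
      (Fintype.card F : ℝ) ≤ C * M ^ 103 * #A ∨ (#B : ℝ) ≤ C * K * M ^ 3 * D ∨
      (#B : ℝ) ^ 2 ≤ C * K ^ 2 * M ^ 109 * #A := by
  obtain ⟨C, hC, hC1, hC2⟩ : ∃ C : ℝ, 384 ≤ C ∧ 393216 ≤ C ∧ 73728 * 393216 ^ 4 ≤ C :=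
    ⟨_, by norm_num, by norm_num, le_refl _⟩
  have hC0 : 1 ≤ C := by linarith
  have hC0' : 0 < C := by linarith
  refine ⟨4096 * C ^ 17, by
    have := one_le_pow₀ hC0 (n := 17)
    linarith, ?_⟩
  intro F _ _ _ A B hA hB K D M hK hM hG hT
  have hM0 : 0 < M := by linarith
  obtain ⟨X, hXA, V, hVA, T, s, c, d, h0T, hs, hc, hX, hV, hTc, hsum, hTX, hTV⟩ :=
    exists_subsets_of_properTriples A B hA hB M hM0 hT
  have hn : (0 : ℝ) < #B := by exact_mod_cast hB.card_pos
  have hN : (0 : ℝ) < #A := by exact_mod_cast hA.card_pos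
  have hXN : (#X : ℝ) ≤ #A := by exact_mod_cast card_le_card hXA
  set h : ℝ := C * M ^ 25 * #A with hh
  replace hX : (#A : ℝ) / (C * M) ≤ #X := le_trans (by gcongr; linarith) hX
  replace hV : (#A : ℝ) / (C * M) ≤ #V := le_trans (by gcongr; linarith) hV
  replace hTc : (#B : ℝ) / (C * M ^ 3) ≤ #T := le_trans (by gcongr) hTc
  replace hsum : (#(X + s • V) : ℝ) ≤ C * M ^ 5 * #A := hsum.trans (by gcongr)
  replace hTV : ∀ t ∈ T, (#(X + t • V) : ℝ) ≤ h := fun t ht => (hTV t ht).trans (by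
    rw [hh]
    gcongr)
  have hXpos : (0 : ℝ) < #X := lt_of_lt_of_le (by positivity) hX
  have hVpos : (0 : ℝ) < #V := lt_of_lt_of_le (by positivity) hV
  have hTpos : (0 : ℝ) < #T := lt_of_lt_of_le (by positivity) hTc
  have hXne : X.Nonempty := card_pos.1 (by exact_mod_cast hXpos)
  have hVne : V.Nonempty := card_pos.1 (by exact_mod_cast hVpos)
  have hTne : T.Nonempty := card_pos.1 (by exact_mod_cast hTpos)
  have hXh : (#X : ℝ) ≤ h := by
    refine hXN.trans ?_
    rw [hh]
    have : 1 ≤ C * M ^ 25 := one_le_mul_of_one_le_of_one_le hC0 (one_le_pow₀ hM)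
    nlinarith
  have hpos : 0 < h := by positivity
  -- Here 103 = 4·25 + 3. This exponent is the source of the q^(-1/103) term.
  have j4 : (4 * h / #X) ^ 4 * #X ≤ 256 * C ^ 7 * M ^ 103 * #A := by
    calc (4 * h / #X) ^ 4 * #X = (4 * h) ^ 4 / (#X : ℝ) ^ 3 := by field_simp
      _ ≤ (4 * h) ^ 4 / ((#A : ℝ) / (C * M)) ^ 3 := by gcongr
      _ = _ := by
        rw [hh]
        field_simp
        norm_num
  have j6 : (4 * h / #X) ^ 6 * #X ≤ 4096 * C ^ 11 * M ^ 155 * #A := by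
    calc (4 * h / #X) ^ 6 * #X = (4 * h) ^ 6 / (#X : ℝ) ^ 5 := by field_simp
      _ ≤ (4 * h) ^ 6 / ((#A : ℝ) / (C * M)) ^ 5 := by gcongr
      _ = _ := by
        rw [hh]
        field_simp
        norm_num
  have mono : ∀ k ≤ 17, C ^ k ≤ C ^ 17 := fun k hk => pow_le_pow_right₀ hC0 hk
  rcases exists_subfield_or_card_le hXne hTne h0T hs hc hTX hXh hVne hTV with
    ⟨G, u, hu, hGT, hGV⟩ | hi | hii
  · classical
    obtain ⟨r, hr, hmin⟩ := exists_min_le_card_sub_smul V (univ.filter (· ∈ G)) hVne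
      ⟨0, by simp [zero_mem]⟩
    have hr' := (hGV r (mem_filter.1 hr).2).trans j4
    have hGcard : #(univ.filter (· ∈ G)) = Nat.card G := by
      rw [Nat.card_eq_fintype_card]
      exact (Fintype.card_subtype _).symm
    rw [hGcard] at hmin
    have hor : (#V : ℝ) ^ 2 ≤ 512 * C ^ 7 * M ^ 103 * #A ∨
        (Nat.card G : ℝ) ≤ 512 * C ^ 7 * M ^ 103 * #A := by
      rcases min_le_iff.1 hmin with h1 | h1
      · left
        have : (#V : ℝ) ^ 2 ≤ 2 * #(V - r • V) := by exact_mod_cast h1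
        linarith
      · right
        have : (Nat.card G : ℝ) ≤ 2 * #(V - r • V) := by exact_mod_cast h1
        linarith
    rcases hor with h1 | h1
    · right; left
      have h2 : ((#A : ℝ) / (C * M)) ^ 2 ≤ 512 * C ^ 7 * M ^ 103 * #A :=
        le_trans (by gcongr) h1
      rw [div_pow, div_le_iff₀ (by positivity)] at h2
      have h3 : (#A : ℝ) * #A ≤ (512 * C ^ 9 * M ^ 105) * #A := by
        calc (#A : ℝ) * #A = #A ^ 2 := by ring
          _ ≤ _ := h2
          _ = _ := by ring
      have h4 := le_of_mul_le_mul_right h3 hN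
      refine h4.trans ?_
      have := mono 9 (by norm_num)
      gcongr
      norm_num
    · by_cases hGtop : G = ⊤
      · right; right; left
        have h2 : (Nat.card G : ℝ) = Fintype.card F := by
          rw [hGtop, ← Nat.card_eq_fintype_card]
          norm_cast
          exact Nat.card_congr (Subfield.topEquiv (K := F)).toEquiv
        rw [← h2]
        refine h1.trans ?_
        have := mono 7 (by norm_num)
        gcongr
        norm_num
      · right; right; right
        -- Since tc + d = (uc)(t/u) + d with t/u ∈ G, the copy of `T` inside `A` lies in an affine
        -- image of `G`.
        have h2 : (#T : ℝ) ≤ K * max ((Nat.card G : ℝ) ^ ((1 : ℝ) / 2)) D := by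
          refine le_trans ?_ (hG G hGtop (u * c) d)
          norm_cast
          rw [← Set.ncard_coe_finset]
          refine Set.ncard_le_ncard_of_injOn (fun t => t * c + d) ?_ ?_ (Set.toFinite _)
          · intro t ht
            refine ⟨hXA (hTX t ht), t / u, hGT t ht, ?_⟩
            field_simp
          · intro t _ t' _ htt
            simpa [hc] using htt
        rcases le_total ((Nat.card G : ℝ) ^ ((1 : ℝ) / 2)) D with h3 | h3
        · left
          rw [max_eq_right h3] at h2
          have h4 := hTc.trans h2
          have hD0 : 0 ≤ D := le_trans (by positivity) h3
          rw [div_le_iff₀ (by positivity)] at h4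
          refine h4.trans ?_
          have := mono 1 (by norm_num)
          calc K * D * (C * M ^ 3) = C ^ 1 * K * M ^ 3 * D := by ring
            _ ≤ (4096 * C ^ 17) * K * M ^ 3 * D := by
              gcongr
              linarith [pow_pos hC0' 17]
        · right
          rw [max_eq_left h3] at h2
          have h4 := hTc.trans h2
          have h5 : ((#B : ℝ) / (C * M ^ 3)) ^ 2 ≤ K ^ 2 * Nat.card G := by
            calc ((#B : ℝ) / (C * M ^ 3)) ^ 2
                ≤ (K * (Nat.card G : ℝ) ^ ((1 : ℝ) / 2)) ^ 2 := by gcongr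
              _ = K ^ 2 * Nat.card G := by
                rw [mul_pow, ← Real.sqrt_eq_rpow, Real.sq_sqrt (by positivity)]
          have h6 : ((#B : ℝ) / (C * M ^ 3)) ^ 2 ≤ K ^ 2 * (512 * C ^ 7 * M ^ 103 * #A) :=
            h5.trans (by gcongr)
          rw [div_pow, div_le_iff₀ (by positivity)] at h6
          refine h6.trans ?_
          have := mono 9 (by norm_num)
          calc _ = 512 * C ^ 9 * K ^ 2 * M ^ 109 * #A := by ring
            _ ≤ _ := by
              gcongr
              norm_num
  · left
    -- The powers of M add up to 6 + 2 + 10 + 155 = 173; the multiplicative alternative below gives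
    -- 6 + 2 + 2 + 10 + 50 + 103, again 173.
    have h1 : ((#B : ℝ) / (C * M ^ 3)) ^ 2 * ((#A : ℝ) / (C * M)) ^ 2 ≤
        (C * M ^ 5 * #A) ^ 2 * (4096 * C ^ 11 * M ^ 155 * #A) :=
      calc _ ≤ (#T : ℝ) ^ 2 * #V ^ 2 := by gcongr
        _ ≤ _ := hi
        _ ≤ _ := by gcongr
    rw [div_pow, div_pow, div_mul_div_comm, div_le_iff₀ (by positivity)] at h1
    refine le_of_mul_le_mul_right (a := (#A : ℝ) ^ 2) (h1.trans (le_of_eq ?_)) (by positivity)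
    ring
  · left
    have h1 : ((#B : ℝ) / (C * M ^ 3)) ^ 2 * ((#A : ℝ) / (C * M)) ^ 2 *
        ((#A : ℝ) / (C * M) * ((#A : ℝ) / (C * M))) ≤
        (C * M ^ 5 * #A) ^ 2 * (h * h * (256 * C ^ 7 * M ^ 103 * #A)) :=
      calc _ ≤ (#T : ℝ) ^ 2 * #V ^ 2 * (#V * #X) := by gcongr
        _ ≤ _ := hii
        _ ≤ _ := by gcongr
    rw [hh, div_pow, div_pow, div_mul_div_comm, div_mul_div_comm, div_mul_div_comm,
      div_le_iff₀ (by positivity)] at h1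
    refine le_of_mul_le_mul_right (a := (#A : ℝ) ^ 4) ?_ (by positivity)
    calc _ = (#B : ℝ) ^ 2 * #A ^ 2 * (#A * #A) := by ring
      _ ≤ _ := h1
      _ = 256 * C ^ 17 * M ^ 173 * #A * #A ^ 4 := by ring
      _ ≤ _ := by
        gcongr
        norm_num

theorem rpow_eq_pow_rpow {x r s : ℝ} (hx : 0 ≤ x) (a : ℕ) (hr : r = s * a) :
    x ^ r = (x ^ s) ^ a := by
  rw [hr, Real.rpow_mul_natCast hx]

theorem mul_pow_lt_mul_pow {M E P : ℝ} {j k : ℕ} (hM : 1 ≤ M) (hE : 1 ≤ E) (hPE : P < E)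
    (hk : k ≠ 0) (hjk : j ≤ k) : P * M ^ j < (M * E) ^ k := by
  have hM0 : 0 < M := by linarith
  calc P * M ^ j < E * M ^ j := by gcongr
    _ ≤ E ^ k * M ^ k := by
      gcongr
      · exact le_self_pow₀ hE hk
    _ = _ := by rw [mul_pow, mul_comm]

set_option maxHeartbeats 1000000 in
-- By contradiction, with M defined by exact equality in the triple count. A count beyond the bound
-- makes M so small that every alternative of `bounds_of_properTriples` fails.
theorem collinearTriples_bound (K : ℝ) (hK : 0 < K) :
    ∃ C : ℝ, 0 < C ∧
      ∀ (F : Type*) [Field F] [Fintype F] (A B : Finset F),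
        2 ≤ B.card → B.card ≤ A.card →
        (∀ G : Subfield F, G ≠ ⊤ → ∀ c d : F,
          (((A : Set F) ∩ ((fun g : F => c * g + d) '' (G : Set F))).ncard : ℝ) ≤
            K * max ((Nat.card G : ℝ) ^ ((1 : ℝ) / 2))
              ((A.card : ℝ) ^ ((31 : ℝ) / 191) * (B.card : ℝ) ^ ((129 : ℝ) / 191))) →
        (collinearTriples A B : ℝ) ≤
            C * ((A.card : ℝ) ^ ((383 : ℝ) / 191) * (B.card : ℝ) ^ ((571 : ℝ) / 191)
              + (Fintype.card F : ℝ) ^ (-(1 : ℝ) / 103)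
                  * (A.card : ℝ) ^ ((207 : ℝ) / 103) * (B.card : ℝ) ^ 3
              + (A.card : ℝ) ^ 3 * (B.card : ℝ)) := by
  obtain ⟨C, hC, hbounds⟩ := bounds_of_properTriples
  -- `E` exceeds each of the constants C, CK and CK² occurring in the alternatives, so strict
  -- contradictions result.
  set E : ℝ := C * (1 + K + K ^ 2) + 1 with hE
  have hCK : 0 < C * K := by positivity
  have hCK2 : 0 < C * K ^ 2 := by positivity
  have hE' : E = C + C * K + C * K ^ 2 + 1 := by rw [hE]; ring
  clear_value E
  have hE1 : 1 ≤ E := by linarith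
  refine ⟨E + 4, by linarith, ?_⟩
  intro F _ _ A B hB hBA hG
  classical
  by_contra! hcon
  have hA1 : 1 ≤ #A := by omega
  have hN1 : (1 : ℝ) ≤ #A := by exact_mod_cast hA1
  have hn1 : (1 : ℝ) ≤ #B := by exact_mod_cast (by omega : 1 ≤ #B)
  have hq0 : (0 : ℝ) < Fintype.card F := by exact_mod_cast Fintype.card_pos
  have hAne : A.Nonempty := card_pos.1 hA1
  have hBne : B.Nonempty := card_pos.1 (by omega)
  have htriv := collinearTriples_le A B hBA
  have htriv' : (collinearTriples A B : ℝ) ≤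
      #(properTriples A B) + (#A : ℝ) ^ 3 * #B + 4 * ((#A : ℝ) ^ 2 * #B ^ 2) := by
    exact_mod_cast htriv
  have hupper : (#(properTriples A B) : ℝ) ≤ (#A : ℝ) ^ 2 * #B ^ 3 := by
    exact_mod_cast card_properTriples_le A B
  have hBA' : (#B : ℝ) ≤ #A := by exact_mod_cast hBA
  have hbd := hbounds A B hAne hBne K ((#A : ℝ) ^ ((31 : ℝ) / 191) * (#B : ℝ) ^ ((129 : ℝ) / 191))
  set N : ℝ := (#A : ℝ) with hN
  set n : ℝ := (#B : ℝ) with hn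
  set q : ℝ := (Fintype.card F : ℝ) with hq
  set T : ℝ := (#(properTriples A B) : ℝ) with hT
  clear_value N n q T
  have hN0 : 0 ≤ N := by linarith
  have hn0 : 0 ≤ n := by linarith
  -- Passing to 191st and 103rd roots turns all real exponents into natural ones.
  set α : ℝ := N ^ ((1 : ℝ) / 191) with hα
  set β : ℝ := n ^ ((1 : ℝ) / 191) with hβ
  set γ : ℝ := N ^ ((1 : ℝ) / 103) with hγ
  set κ : ℝ := q ^ ((1 : ℝ) / 103) with hκ
  have hα1 : 1 ≤ α := Real.one_le_rpow hN1 (by norm_num)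
  have hβ1 : 1 ≤ β := Real.one_le_rpow hn1 (by norm_num)
  have hγ1 : 1 ≤ γ := Real.one_le_rpow hN1 (by norm_num)
  have hκ0 : 0 < κ := Real.rpow_pos_of_pos hq0 _
  have hαN : N = α ^ 191 := by rw [hα, ← rpow_eq_pow_rpow hN0 191 (r := 1) (by norm_num), Real.rpow_one]
  have hβn : n = β ^ 191 := by rw [hβ, ← rpow_eq_pow_rpow hn0 191 (r := 1) (by norm_num), Real.rpow_one]
  have hγN : N = γ ^ 103 := by rw [hγ, ← rpow_eq_pow_rpow hN0 103 (r := 1) (by norm_num), Real.rpow_one]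
  have hκq : q = κ ^ 103 := by
    rw [hκ, ← rpow_eq_pow_rpow hq0.le 103 (r := 1) (by norm_num), Real.rpow_one]
  have e1 : N ^ ((383 : ℝ) / 191) = α ^ 383 := rpow_eq_pow_rpow hN0 383 (by norm_num)
  have e2 : n ^ ((571 : ℝ) / 191) = β ^ 571 := rpow_eq_pow_rpow hn0 571 (by norm_num)
  have e3 : N ^ ((31 : ℝ) / 191) = α ^ 31 := rpow_eq_pow_rpow hN0 31 (by norm_num)
  have e4 : n ^ ((129 : ℝ) / 191) = β ^ 129 := rpow_eq_pow_rpow hn0 129 (by norm_num)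
  have e5 : N ^ ((207 : ℝ) / 103) = γ ^ 207 := rpow_eq_pow_rpow hN0 207 (by norm_num)
  have e6 : q ^ (-(1 : ℝ) / 103) = κ⁻¹ := by
    rw [neg_div, Real.rpow_neg hq0.le]
  rw [e1, e2, e5, e6] at hcon
  rw [e3, e4] at hbd hG
  clear_value α β γ κ
  have hα0 : 0 < α := by linarith
  have hβ0 : 0 < β := by linarith
  have hγ0 : 0 < γ := by linarith
  set t₁ : ℝ := α ^ 383 * β ^ 571 with ht₁
  set t₂ : ℝ := κ⁻¹ * γ ^ 207 * n ^ 3 with ht₂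
  have ht₁0 : 0 < t₁ := by positivity
  have ht₂0 : 0 < t₂ := by positivity
  have hsq : N ^ 2 * n ^ 2 ≤ t₁ := by
    rw [hαN, hβn, ht₁, ← pow_mul, ← pow_mul]
    gcongr <;> first | assumption | norm_num
  -- The extra 4 in the constant absorbs the degenerate triples, using `hsq` and the |A|³|B| term.
  have hTlow : E * (t₁ + t₂) ≤ T := by
    have h3 : 0 ≤ N ^ 3 * n := by positivity
    have h4 : 0 ≤ (E - 1) * (N ^ 3 * n) := mul_nonneg (by linarith) h3
    linarith
  have hTpos : 0 < T := lt_of_lt_of_le (by positivity) hTlow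
  set M : ℝ := N ^ 2 * n ^ 3 / T with hM
  have hMT : M * T = N ^ 2 * n ^ 3 := div_mul_cancel₀ _ hTpos.ne'
  have hM1 : 1 ≤ M := (one_le_div hTpos).2 hupper
  have hM0 : 0 < M := by linarith
  clear_value M
  have hw₁ : M * E * α ≤ β ^ 2 := by
    have h1 : M * (E * t₁) ≤ N ^ 2 * n ^ 3 := by
      rw [← hMT]
      have : 0 ≤ E * t₂ := by positivity
      gcongr
      linarith
    have h2 : (M * E * α) * (α ^ 382 * β ^ 571) ≤ β ^ 2 * (α ^ 382 * β ^ 571) := by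
      calc _ = M * (E * t₁) := by rw [ht₁]; ring
        _ ≤ N ^ 2 * n ^ 3 := h1
        _ = _ := by rw [hαN, hβn]; ring
    exact le_of_mul_le_mul_right h2 (by positivity)
  have hw₂ : M * E * γ ≤ κ := by
    have h1 : M * (E * t₂) ≤ N ^ 2 * n ^ 3 := by
      rw [← hMT]
      have : 0 ≤ E * t₁ := by positivity
      gcongr
      linarith
    have h2 : (M * E * γ) * (γ ^ 206 * n ^ 3 * κ⁻¹) ≤ κ * (γ ^ 206 * n ^ 3 * κ⁻¹) := by
      calc _ = M * (E * t₂) := by rw [ht₂]; ring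
        _ ≤ N ^ 2 * n ^ 3 := h1
        _ = _ := by
          rw [hγN]
          field_simp
    exact le_of_mul_le_mul_right h2 (by positivity)
  have hw191 : (M * E) ^ 191 * N ≤ n ^ 2 := by
    calc _ = (M * E * α) ^ 191 := by rw [hαN]; ring
      _ ≤ (β ^ 2) ^ 191 := by gcongr
      _ = _ := by rw [hβn]; ring
  have hN0' : 0 < N := by linarith
  -- `hw191` tolerates any power of M up to 191, so the exponents 173, 105 and 109 are all covered.
  have key : ∀ {P : ℝ} {j : ℕ}, P < E → j ≤ 191 → n ^ 2 ≤ P * M ^ j * N → False := by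
    intro P j hP hj h
    have h1 := le_of_mul_le_mul_right (hw191.trans h) hN0'
    exact absurd h1 (not_le.2 (mul_pow_lt_mul_pow hM1 hE1 hP (by norm_num) hj))
  rcases hbd M hK.le hM1 hG (by rw [← hMT, mul_div_cancel_left₀ _ hM0.ne']) with
    h | h | h | h | h
  · exact key (by linarith) (by norm_num) h
  · refine key (P := C) (j := 105) (by linarith) (by norm_num) ?_
    calc n ^ 2 ≤ N * N := by nlinarith
      _ ≤ _ := by gcongr
  · have h1 : (M * E) ^ 103 * N ≤ C * M ^ 103 * N := by
      calc _ = (M * E * γ) ^ 103 := by rw [hγN]; ring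
        _ ≤ κ ^ 103 := by gcongr
        _ ≤ _ := by rwa [← hκq]
    have h2 := le_of_mul_le_mul_right h1 hN0'
    exact absurd h2 (not_le.2
      (mul_pow_lt_mul_pow hM1 hE1 (by linarith) (by norm_num) le_rfl))
  -- The exponents 31 and 129 = 191 - 62 fit here: raising `hw₁` to the power 31 turns |B| = β¹⁹¹
  -- into a multiple of the threshold.
  · have h1 : (M * E) ^ 31 * (α ^ 31 * β ^ 129) ≤ (C * K) * M ^ 3 * (α ^ 31 * β ^ 129) := by
      calc _ = (M * E * α) ^ 31 * β ^ 129 := by ring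
        _ ≤ (β ^ 2) ^ 31 * β ^ 129 := by gcongr
        _ = n := by rw [hβn]; ring
        _ ≤ _ := h
    have h2 := le_of_mul_le_mul_right h1 (by positivity)
    exact absurd h2 (not_le.2
      (mul_pow_lt_mul_pow hM1 hE1 (by linarith) (by norm_num) (by norm_num)))
  · exact key (P := C * K ^ 2) (j := 109) (by linarith) (by norm_num) h

/-! ### Incidences and determined lines from collinear triples. -/

theorem IsLine.eq_of_mem {F : Type*} [Field F] {l l' : Set (F × F)} (hl : IsLine l)
    (hl' : IsLine l') {p p' : F × F} (hne : p ≠ p') (hp : p ∈ l) (hp' : p' ∈ l) (hq : p ∈ l')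
    (hq' : p' ∈ l') : l = l' := by
  obtain ⟨a, b, c, hab, rfl⟩ := hl
  obtain ⟨a', b', c', hab', rfl⟩ := hl'
  simp only [Set.mem_ofPred_eq] at hp hp' hq hq'
  have hdet : a * b' = a' * b := by
    by_contra hdet
    have hdet' := sub_ne_zero.2 hdet
    apply hne
    refine Prod.ext (mul_left_cancel₀ hdet' ?_) (mul_left_cancel₀ hdet' ?_)
    · linear_combination b' * (hp - hp') - b * (hq - hq')
    · linear_combination a * (hq - hq') - a' * (hp - hp')
  ext ⟨x, y⟩
  simp only [Set.mem_ofPred_eq]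
  have h1 : a' * (a * x + b * y - c) = a * (a' * x + b' * y - c') := by
    linear_combination -y * hdet + a' * hp - a * hq + p.2 * hdet
  have h2 : b' * (a * x + b * y - c) = b * (a' * x + b' * y - c') := by
    linear_combination x * hdet + b' * hp - b * hq - p.1 * hdet
  constructor
  · intro h
    have h0 : a * x + b * y - c = 0 := sub_eq_zero.2 h
    rw [h0, mul_zero] at h1 h2
    rcases hab with h3 | h3
    · exact sub_eq_zero.1 ((mul_eq_zero.1 h1.symm).resolve_left h3)
    · exact sub_eq_zero.1 ((mul_eq_zero.1 h2.symm).resolve_left h3)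
  · intro h
    have h0 : a' * x + b' * y - c' = 0 := sub_eq_zero.2 h
    rw [h0, mul_zero] at h1 h2
    rcases hab' with h3 | h3
    · exact sub_eq_zero.1 ((mul_eq_zero.1 h1).resolve_left h3)
    · exact sub_eq_zero.1 ((mul_eq_zero.1 h2).resolve_left h3)

theorem IsLine.collinear {F : Type*} [Field F] {l : Set (F × F)} (hl : IsLine l)
    {p p' p'' : F × F} (hp : p ∈ l) (hp' : p' ∈ l) (hp'' : p'' ∈ l) :
    (p'.1 - p.1) * (p''.2 - p.2) = (p''.1 - p.1) * (p'.2 - p.2) := by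
  obtain ⟨a, b, c, hab, rfl⟩ := hl
  simp only [Set.mem_ofPred_eq] at hp hp' hp''
  rcases hab with h | h
  · apply mul_left_cancel₀ h
    linear_combination (p''.2 - p.2) * (hp' - hp) - (p'.2 - p.2) * (hp'' - hp)
  · apply mul_left_cancel₀ h
    linear_combination (p'.1 - p.1) * (hp'' - hp) - (p''.1 - p.1) * (hp' - hp)

theorem exists_isLine {F : Type*} [Field F] {p p' : F × F} (hne : p ≠ p') :
    ∃ l : Set (F × F), IsLine l ∧ p ∈ l ∧ p' ∈ l := by
  refine ⟨_, ⟨p'.2 - p.2, p.1 - p'.1, (p'.2 - p.2) * p.1 + (p.1 - p'.1) * p.2, ?_, rfl⟩, ?_, ?_⟩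
  · by_contra! h
    exact hne (Prod.ext (sub_eq_zero.1 h.2) (sub_eq_zero.1 h.1).symm)
  · rfl
  · simp only [Set.mem_ofPred_eq]
    ring

open Classical in
-- Counts, on each line, triples in which two specified points differ; those two points determine
-- the line, so no triple is counted twice.
theorem sum_sq_mul_le_collinearTriples {F : Type*} [Field F] (A B : Finset F)
    (L : Finset (Set (F × F))) (hL : ∀ l ∈ L, IsLine l) :
    ∑ l ∈ L, #{p ∈ A ×ˢ B | p ∈ l} * (#{p ∈ A ×ˢ B | p ∈ l} * (#{p ∈ A ×ˢ B | p ∈ l} - 1)) ≤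
      collinearTriples A B := by
  have e : ∀ l ∈ L, #{p ∈ A ×ˢ B | p ∈ l} *
      (#{p ∈ A ×ˢ B | p ∈ l} * (#{p ∈ A ×ˢ B | p ∈ l} - 1)) =
      #({p ∈ A ×ˢ B | p ∈ l} ×ˢ ({p ∈ A ×ˢ B | p ∈ l}).offDiag) := by
    intro l _
    rw [card_product, offDiag_card, Nat.mul_sub, mul_one]
  rw [sum_congr rfl e, ← card_sigma]
  refine card_le_card_of_injOn (fun x => ((x.2.2.1.1, x.2.2.2.1, x.2.1.1),
    (x.2.2.1.2, x.2.2.2.2, x.2.1.2))) ?_ ?_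
  · rintro ⟨l, p, p', p''⟩ hx
    simp only [coe_sigma, Set.mem_sigma_iff, mem_coe, mem_product, mem_offDiag, mem_filter] at hx
    obtain ⟨hl, ⟨⟨h1, h2⟩, h3⟩, ⟨⟨h4, h5⟩, h6⟩, ⟨⟨h7, h8⟩, h9⟩, -⟩ := hx
    exact mem_filter.2 ⟨by simp [*], (hL l hl).collinear h6 h9 h3⟩
  · rintro ⟨l, p, p', p''⟩ hx ⟨l₁, p₁, p₁', p₁''⟩ hx₁ hxx
    simp only [coe_sigma, Set.mem_sigma_iff, mem_coe, mem_product, mem_offDiag, mem_filter]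
      at hx hx₁
    obtain ⟨hl, ⟨-, h3⟩, ⟨-, h6⟩, ⟨-, h9⟩, hne⟩ := hx
    obtain ⟨hl₁, ⟨-, h3₁⟩, ⟨-, h6₁⟩, ⟨-, h9₁⟩, -⟩ := hx₁
    simp only [Prod.mk.injEq] at hxx
    obtain ⟨⟨f1, f2, f3⟩, f4, f5, f6⟩ := hxx
    obtain rfl : p = p₁ := Prod.ext f3 f6
    obtain rfl : p' = p₁' := Prod.ext f1 f4
    obtain rfl : p'' = p₁'' := Prod.ext f2 f5
    obtain rfl := (hL l hl).eq_of_mem (hL l₁ hl₁) hne h6 h9 h6₁ h9₁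
    rfl

open Classical in
theorem sum_cube_le_collinearTriples {F : Type*} [Field F] (A B : Finset F)
    (L : Finset (Set (F × F))) (hL : ∀ l ∈ L, IsLine l)
    (hL2 : ∀ l ∈ L, 2 ≤ #{p ∈ A ×ˢ B | p ∈ l}) :
    ∑ l ∈ L, #{p ∈ A ×ˢ B | p ∈ l} ^ 3 ≤ 2 * collinearTriples A B := by
  refine le_trans ?_ (Nat.mul_le_mul_left 2 (sum_sq_mul_le_collinearTriples A B L hL))
  rw [mul_sum]
  refine sum_le_sum fun l hl => ?_
  obtain ⟨k, hk⟩ := Nat.exists_eq_add_of_le (hL2 l hl)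
  rw [hk, show 2 + k - 1 = k + 1 by omega]
  nlinarith [sq_nonneg k, Nat.zero_le (k ^ 3), Nat.zero_le (k ^ 2)]

/-- Hölder's inequality for the cubic moment over lines with at least two points; the other lines
contribute at most |L|. -/
theorem incidences_le {F : Type*} [Field F] (A B : Finset F)
    (L : Finset (Set (F × F))) (hL : ∀ l ∈ L, IsLine l) {T : ℝ} (hT : 0 < T)
    (hTle : (collinearTriples A B : ℝ) ≤ T) :
    (incidences (A ×ˢ B) L : ℝ) ≤ 3 * (T ^ ((1 : ℝ) / 3) * (#L : ℝ) ^ ((2 : ℝ) / 3)) + #L := by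
  classical
  set m : Set (F × F) → ℕ := fun l => #{p ∈ A ×ˢ B | p ∈ l} with hm
  have hI : incidences (A ×ˢ B) L = ∑ l ∈ L, m l := by
    unfold incidences
    simp only [hm, card_filter, sum_product_right]
  set L₂ : Finset (Set (F × F)) := {l ∈ L | 2 ≤ m l} with hL₂
  have hcube : (∑ l ∈ L₂, (m l : ℝ) ^ 3) ≤ 2 * T := by
    have h1 := sum_cube_le_collinearTriples A B L₂ (fun l hl => hL l (mem_filter.1 hl).1)
      (fun l hl => (mem_filter.1 hl).2)
    have h2 : (∑ l ∈ L₂, (m l : ℝ) ^ 3) ≤ 2 * collinearTriples A B := by exact_mod_cast h1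
    linarith
  have hsplit : (∑ l ∈ L, (m l : ℝ)) ≤ (∑ l ∈ L₂, (m l : ℝ)) + #L := by
    rw [← sum_filter_add_sum_filter_not L (fun l => 2 ≤ m l)]
    gcongr
    calc ∑ l ∈ L with ¬ 2 ≤ m l, (m l : ℝ) ≤ ∑ l ∈ L with ¬ 2 ≤ m l, (1 : ℝ) := by
          refine sum_le_sum fun l hl => ?_
          have := (mem_filter.1 hl).2
          exact_mod_cast (by omega : m l ≤ 1)
      _ = #{l ∈ L | ¬ 2 ≤ m l} := by simp
      _ ≤ #L := by exact_mod_cast card_le_card (filter_subset _ _)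
  rw [hI]
  push_cast
  refine hsplit.trans ?_
  gcongr
  rcases L.eq_empty_or_nonempty with rfl | hLne
  · simp [hL₂]
  have hLpos : (0 : ℝ) < #L := by exact_mod_cast hLne.card_pos
  set t : ℝ := T ^ ((1 : ℝ) / 3) with ht
  set y : ℝ := (#L : ℝ) ^ ((1 : ℝ) / 3) with hy
  have ht0 : 0 < t := Real.rpow_pos_of_pos hT _
  have hy0 : 0 < y := Real.rpow_pos_of_pos hLpos _
  have ht3 : T = t ^ 3 := by
    rw [ht, ← rpow_eq_pow_rpow hT.le 3 (r := 1) (by norm_num), Real.rpow_one]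
  have hy3 : (#L : ℝ) = y ^ 3 := by
    rw [hy, ← rpow_eq_pow_rpow hLpos.le 3 (r := 1) (by norm_num), Real.rpow_one]
  have hy2 : (#L : ℝ) ^ ((2 : ℝ) / 3) = y ^ 2 := rpow_eq_pow_rpow hLpos.le 2 (by norm_num)
  rw [hy2]
  clear_value t y m
  -- Hölder in pointwise form, splitting at the threshold t/y = (T/|L|)^(1/3).
  have hpt : ∀ l ∈ L₂, (m l : ℝ) ≤ (y / t) ^ 2 * (m l : ℝ) ^ 3 + t / y := by
    intro l _
    have h0 : (0 : ℝ) ≤ m l := Nat.cast_nonneg _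
    rcases le_total (m l : ℝ) (t / y) with h | h
    · have : 0 ≤ (y / t) ^ 2 * (m l : ℝ) ^ 3 := by positivity
      linarith
    · have h1 : 1 ≤ (y / t) * m l := by
        calc 1 = (y / t) * (t / y) := by field_simp
          _ ≤ _ := by gcongr
      have h2 : 1 ≤ ((y / t) * m l) ^ 2 := one_le_pow₀ h1
      have h3 : 0 < t / y := by positivity
      calc (m l : ℝ) = 1 * m l := by ring
        _ ≤ ((y / t) * m l) ^ 2 * m l := by gcongr
        _ = (y / t) ^ 2 * (m l : ℝ) ^ 3 := by ring
        _ ≤ _ := by linarith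
  calc (∑ l ∈ L₂, (m l : ℝ)) ≤ ∑ l ∈ L₂, ((y / t) ^ 2 * (m l : ℝ) ^ 3 + t / y) := sum_le_sum hpt
    _ = (y / t) ^ 2 * ∑ l ∈ L₂, (m l : ℝ) ^ 3 + #L₂ * (t / y) := by
        rw [sum_add_distrib, ← mul_sum, sum_const, nsmul_eq_mul]
    _ ≤ (y / t) ^ 2 * (2 * T) + #L * (t / y) := by
        gcongr
        exact filter_subset _ _
    _ = _ := by
        rw [ht3, hy3]
        field_simp
        ring

theorem card_pow_six_le {F : Type*} [Field F] [Fintype F] (A B : Finset F) (h2 : 2 ≤ #A * #B)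
    {T : ℝ} (hT : 0 < T) (hTle : (collinearTriples A B : ℝ) ≤ T) :
    ((#A : ℝ) * #B) ^ 6 ≤ 256 * T ^ 2 * linesDetermined (A ×ˢ B) := by
  classical
  set LS : Set (Set (F × F)) :=
    {l | IsLine l ∧ ∃ p ∈ A ×ˢ B, ∃ p' ∈ A ×ˢ B, p ≠ p' ∧ p ∈ l ∧ p' ∈ l} with hLS
  have hfin : LS.Finite := Set.toFinite _
  set L : Finset (Set (F × F)) := hfin.toFinset with hL
  have hLcard : linesDetermined (A ×ˢ B) = #L := Set.ncard_eq_toFinset_card _ hfin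
  have hLmem : ∀ l ∈ L, IsLine l ∧ ∃ p ∈ A ×ˢ B, ∃ p' ∈ A ×ˢ B, p ≠ p' ∧ p ∈ l ∧ p' ∈ l :=
    fun l hl => hfin.mem_toFinset.1 hl
  set m : Set (F × F) → ℕ := fun l => #{p ∈ A ×ˢ B | p ∈ l} with hm
  have hcube : (∑ l ∈ L, (m l : ℝ) ^ 3) ≤ 2 * T := by
    have h1 := sum_cube_le_collinearTriples A B L (fun l hl => (hLmem l hl).1) (fun l hl => by
      obtain ⟨-, p, hp, p', hp', hne, hpl, hpl'⟩ := hLmem l hl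
      exact one_lt_card.2 ⟨p, mem_filter.2 ⟨hp, hpl⟩, p', mem_filter.2 ⟨hp', hpl'⟩, hne⟩)
    have h2 : (∑ l ∈ L, (m l : ℝ) ^ 3) ≤ 2 * collinearTriples A B := by exact_mod_cast h1
    linarith
  set P : ℝ := (#A : ℝ) * #B with hP
  have hP2 : 2 ≤ P := by
    rw [hP]
    exact_mod_cast h2
  have hpairs : P ^ 2 / 2 ≤ ∑ l ∈ L, (m l : ℝ) ^ 2 := by
    have h3 : #(A ×ˢ B).offDiag ≤ ∑ l ∈ L, m l ^ 2 := by
      have h4 : (A ×ˢ B).offDiag ⊆ L.biUnion fun l =>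
          {p ∈ A ×ˢ B | p ∈ l} ×ˢ {p ∈ A ×ˢ B | p ∈ l} := by
        rintro ⟨p, p'⟩ hpp
        obtain ⟨hp, hp', hne⟩ := mem_offDiag.1 hpp
        obtain ⟨l, hl, hpl, hpl'⟩ := exists_isLine hne
        exact mem_biUnion.2 ⟨l, hfin.mem_toFinset.2 ⟨hl, p, hp, p', hp', hne, hpl, hpl'⟩,
          mem_product.2 ⟨mem_filter.2 ⟨hp, hpl⟩, mem_filter.2 ⟨hp', hpl'⟩⟩⟩
      refine (card_le_card h4).trans (card_biUnion_le.trans (le_of_eq ?_))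
      exact sum_congr rfl fun l _ => by rw [card_product, sq]
    have h5 : (#(A ×ˢ B).offDiag : ℝ) = P * P - P := by
      rw [offDiag_card, Nat.cast_sub (Nat.le_mul_self _), card_product]
      push_cast
      rw [hP]
    have h6 : (#(A ×ˢ B).offDiag : ℝ) ≤ ∑ l ∈ L, (m l : ℝ) ^ 2 := by exact_mod_cast h3
    rw [h5] at h6
    nlinarith
  rw [hLcard]
  clear_value P m
  -- Chosen so that lines richer than τ account for at most P²/4, half of the lower bound P²/2 for
  -- the sum of m².
  set τ : ℝ := 8 * T / P ^ 2 with hτ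
  have hP0 : 0 < P := by linarith
  have hτ0 : 0 < τ := by positivity
  have hpt : ∀ l ∈ L, (m l : ℝ) ^ 2 ≤ (m l : ℝ) ^ 3 / τ + τ ^ 2 := by
    intro l _
    have h0 : (0 : ℝ) ≤ m l := Nat.cast_nonneg _
    rcases le_total (m l : ℝ) τ with h | h
    · have : 0 ≤ (m l : ℝ) ^ 3 / τ := by positivity
      have : (m l : ℝ) ^ 2 ≤ τ ^ 2 := by gcongr
      linarith
    · have : (m l : ℝ) ^ 2 ≤ (m l : ℝ) ^ 3 / τ := by
        rw [le_div_iff₀ hτ0]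
        calc (m l : ℝ) ^ 2 * τ ≤ (m l : ℝ) ^ 2 * m l := by gcongr
          _ = _ := by ring
      have : 0 ≤ τ ^ 2 := by positivity
      linarith
  have hmain : P ^ 2 / 2 ≤ 2 * T / τ + #L * τ ^ 2 := by
    calc P ^ 2 / 2 ≤ ∑ l ∈ L, (m l : ℝ) ^ 2 := hpairs
      _ ≤ ∑ l ∈ L, ((m l : ℝ) ^ 3 / τ + τ ^ 2) := sum_le_sum hpt
      _ = (∑ l ∈ L, (m l : ℝ) ^ 3) / τ + #L * τ ^ 2 := by
          rw [sum_add_distrib, sum_div, sum_const, nsmul_eq_mul]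
      _ ≤ _ := by gcongr
  have h7 : 2 * T / τ = P ^ 2 / 4 := by
    rw [hτ]
    field_simp
    norm_num
  have h8 : P ^ 2 / 4 ≤ #L * τ ^ 2 := by linarith
  have h9 : (#L : ℝ) * τ ^ 2 = 64 * T ^ 2 * #L / P ^ 4 := by
    rw [hτ]
    field_simp
    norm_num
  rw [h9, le_div_iff₀ (by positivity)] at h8
  calc P ^ 6 = 4 * (P ^ 2 / 4 * P ^ 4) := by ring
    _ ≤ 4 * (64 * T ^ 2 * #L) := by gcongr
    _ = _ := by ring

/-! ### Exponent bookkeeping and conclusion. -/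

theorem rpow_one_third_collinear_bound {C N n q : ℝ} (hC : 0 ≤ C) (hN : 0 ≤ N) (hn : 0 ≤ n)
    (hq : 0 ≤ q) :
    (C * (N ^ ((383 : ℝ) / 191) * n ^ ((571 : ℝ) / 191)
      + q ^ (-(1 : ℝ) / 103) * N ^ ((207 : ℝ) / 103) * n ^ 3 + N ^ 3 * n)) ^ ((1 : ℝ) / 3) ≤
    C ^ ((1 : ℝ) / 3) * (N ^ ((383 : ℝ) / 573) * n ^ ((571 : ℝ) / 573)
      + q ^ (-(1 : ℝ) / 309) * N ^ ((207 : ℝ) / 309) * n + N * n ^ ((1 : ℝ) / 3)) := by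
  have third : ∀ {x : ℝ} (r s : ℝ), 0 ≤ x → s = r * (1 / 3) → x ^ s = (x ^ r) ^ ((1 : ℝ) / 3) := by
    intro x r s hx hrs
    rw [hrs, Real.rpow_mul hx]
  have cube : ∀ {x : ℝ}, 0 ≤ x → x = (x ^ 3) ^ ((1 : ℝ) / 3) := by
    intro x hx
    rw [← Real.rpow_natCast, ← Real.rpow_mul hx]
    norm_num
  rw [Real.mul_rpow hC (by positivity)]
  refine mul_le_mul_of_nonneg_left ?_ (by positivity)
  have e1 : N ^ ((383 : ℝ) / 573) * n ^ ((571 : ℝ) / 573) =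
      (N ^ ((383 : ℝ) / 191) * n ^ ((571 : ℝ) / 191)) ^ ((1 : ℝ) / 3) := by
    rw [Real.mul_rpow (by positivity) (by positivity), ← third _ _ hN, ← third _ _ hn]
    all_goals norm_num
  have e2 : q ^ (-(1 : ℝ) / 309) * N ^ ((207 : ℝ) / 309) * n =
      (q ^ (-(1 : ℝ) / 103) * N ^ ((207 : ℝ) / 103) * n ^ 3) ^ ((1 : ℝ) / 3) := by
    rw [Real.mul_rpow (by positivity) (by positivity), Real.mul_rpow (by positivity)
      (by positivity), ← cube hn, third (-(1 : ℝ) / 103) (-(1 : ℝ) / 309) hq (by norm_num),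
      third ((207 : ℝ) / 103) ((207 : ℝ) / 309) hN (by norm_num)]
  have e3 : N * n ^ ((1 : ℝ) / 3) = (N ^ 3 * n) ^ ((1 : ℝ) / 3) := by
    rw [Real.mul_rpow (by positivity) hn, ← cube hN]
  rw [e1, e2, e3]
  refine (Real.rpow_add_le_add_rpow (by positivity) (by positivity) (by norm_num)
    (by norm_num)).trans ?_
  gcongr
  exact Real.rpow_add_le_add_rpow (by positivity) (by positivity) (by norm_num) (by norm_num)

/-- Each entry of the minimum is (Nn)⁶ divided by the square of one of the three terms. The 9 comes
from (t₁ + t₂ + t₃)² ≤ 3(t₁² + t₂² + t₃²) and three such products. -/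
theorem min_mul_sq_collinear_bound_le {C N n q : ℝ} (hN : 0 < N) (hn : 0 < n) (hq : 0 < q) :
    min (N ^ ((380 : ℝ) / 191) * n ^ ((4 : ℝ) / 191))
        (min (q ^ ((2 : ℝ) / 103) * N ^ ((204 : ℝ) / 103)) (n ^ 4)) *
      (C * (N ^ ((383 : ℝ) / 191) * n ^ ((571 : ℝ) / 191)
        + q ^ (-(1 : ℝ) / 103) * N ^ ((207 : ℝ) / 103) * n ^ 3 + N ^ 3 * n)) ^ 2 ≤
    9 * C ^ 2 * (N * n) ^ 6 := by
  have add : ∀ {x : ℝ} (r s : ℝ), 0 < x → r + 2 * s = 6 → x ^ r * (x ^ s) ^ 2 = x ^ 6 := by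
    intro x r s hx hrs
    rw [← Real.rpow_mul_natCast hx.le, ← Real.rpow_add hx, ← Real.rpow_natCast]
    congr 1
    push_cast
    linarith
  set t₁ : ℝ := N ^ ((383 : ℝ) / 191) * n ^ ((571 : ℝ) / 191) with ht₁
  set t₂ : ℝ := q ^ (-(1 : ℝ) / 103) * N ^ ((207 : ℝ) / 103) * n ^ 3 with ht₂
  set t₃ : ℝ := N ^ 3 * n with ht₃
  set a : ℝ := N ^ ((380 : ℝ) / 191) * n ^ ((4 : ℝ) / 191) with ha
  set b : ℝ := q ^ ((2 : ℝ) / 103) * N ^ ((204 : ℝ) / 103) with hb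
  have h1 : a * t₁ ^ 2 = (N * n) ^ 6 := by
    rw [mul_pow N, ← add ((380 : ℝ) / 191) ((383 : ℝ) / 191) hN (by norm_num),
      ← add ((4 : ℝ) / 191) ((571 : ℝ) / 191) hn (by norm_num), ha, ht₁]
    ring
  have h2 : b * t₂ ^ 2 = (N * n) ^ 6 := by
    have hq' : q ^ ((2 : ℝ) / 103) * (q ^ (-(1 : ℝ) / 103)) ^ 2 = 1 := by
      rw [← Real.rpow_mul_natCast hq.le, ← Real.rpow_add hq]
      norm_num
    calc b * t₂ ^ 2 = (q ^ ((2 : ℝ) / 103) * (q ^ (-(1 : ℝ) / 103)) ^ 2) *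
          (N ^ ((204 : ℝ) / 103) * (N ^ ((207 : ℝ) / 103)) ^ 2) * n ^ 6 := by
          rw [hb, ht₂]
          ring
      _ = _ := by
          rw [hq', add _ _ hN (by norm_num)]
          ring
  have h3 : n ^ 4 * t₃ ^ 2 = (N * n) ^ 6 := by
    rw [ht₃]
    ring
  clear_value t₁ t₂ t₃ a b
  set m := min a (min b (n ^ 4)) with hm
  have m1 : m * t₁ ^ 2 ≤ (N * n) ^ 6 := by
    rw [← h1]
    exact mul_le_mul_of_nonneg_right (min_le_left _ _) (sq_nonneg _)
  have m2 : m * t₂ ^ 2 ≤ (N * n) ^ 6 := by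
    rw [← h2]
    exact mul_le_mul_of_nonneg_right ((min_le_right _ _).trans (min_le_left _ _)) (sq_nonneg _)
  have m3 : m * t₃ ^ 2 ≤ (N * n) ^ 6 := by
    rw [← h3]
    exact mul_le_mul_of_nonneg_right ((min_le_right _ _).trans (min_le_right _ _)) (sq_nonneg _)
  have hm0 : 0 ≤ m := by
    have ha0 : 0 ≤ a := by
      by_contra! h
      have : 0 < (N * n) ^ 6 := by positivity
      nlinarith [sq_nonneg t₁]
    have hb0 : 0 ≤ b := by
      by_contra! h
      have : 0 < (N * n) ^ 6 := by positivity
      nlinarith [sq_nonneg t₂]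
    exact le_min ha0 (le_min hb0 (by positivity))
  have hsq : (t₁ + t₂ + t₃) ^ 2 ≤ 3 * (t₁ ^ 2 + t₂ ^ 2 + t₃ ^ 2) := by
    nlinarith [sq_nonneg (t₁ - t₂), sq_nonneg (t₁ - t₃), sq_nonneg (t₂ - t₃)]
  calc m * (C * (t₁ + t₂ + t₃)) ^ 2 = C ^ 2 * (m * (t₁ + t₂ + t₃) ^ 2) := by ring
    _ ≤ C ^ 2 * (m * (3 * (t₁ ^ 2 + t₂ ^ 2 + t₃ ^ 2))) := by gcongr
    _ = C ^ 2 * (3 * (m * t₁ ^ 2 + m * t₂ ^ 2 + m * t₃ ^ 2)) := by ring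
    _ ≤ C ^ 2 * (3 * ((N * n) ^ 6 + (N * n) ^ 6 + (N * n) ^ 6)) := by gcongr
    _ = _ := by ring

end

theorem theorem1 (K : ℝ) (hK : 0 < K) :
    ∃ C : ℝ, 0 < C ∧
      ∀ (F : Type*) [Field F] [Fintype F] (A B : Finset F),
        2 ≤ B.card → B.card ≤ A.card →
        (∀ G : Subfield F, G ≠ ⊤ → ∀ c d : F,
          (((A : Set F) ∩ ((fun g : F => c * g + d) '' (G : Set F))).ncard : ℝ) ≤
            K * max ((Nat.card G : ℝ) ^ ((1 : ℝ) / 2))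
              ((A.card : ℝ) ^ ((31 : ℝ) / 191) * (B.card : ℝ) ^ ((129 : ℝ) / 191))) →
        ((collinearTriples A B : ℝ) ≤
            C * ((A.card : ℝ) ^ ((383 : ℝ) / 191) * (B.card : ℝ) ^ ((571 : ℝ) / 191)
              + (Fintype.card F : ℝ) ^ (-(1 : ℝ) / 103)
                  * (A.card : ℝ) ^ ((207 : ℝ) / 103) * (B.card : ℝ) ^ 3
              + (A.card : ℝ) ^ 3 * (B.card : ℝ))) ∧
        (∀ L : Finset (Set (F × F)), (∀ l ∈ L, IsLine l) →
          (incidences (A ×ˢ B) L : ℝ) ≤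
            C * (((A.card : ℝ) ^ ((383 : ℝ) / 573) * (B.card : ℝ) ^ ((571 : ℝ) / 573)
              + (Fintype.card F : ℝ) ^ (-(1 : ℝ) / 309)
                  * (A.card : ℝ) ^ ((207 : ℝ) / 309) * (B.card : ℝ)
              + (A.card : ℝ) * (B.card : ℝ) ^ ((1 : ℝ) / 3)) * (L.card : ℝ) ^ ((2 : ℝ) / 3)
              + (L.card : ℝ))) ∧
        (min ((A.card : ℝ) ^ ((380 : ℝ) / 191) * (B.card : ℝ) ^ ((4 : ℝ) / 191))
            (min ((Fintype.card F : ℝ) ^ ((2 : ℝ) / 103) * (A.card : ℝ) ^ ((204 : ℝ) / 103))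
              ((B.card : ℝ) ^ 4)) ≤
          C * (linesDetermined (A ×ˢ B) : ℝ)) := by
  obtain ⟨C, hC, hbound⟩ := collinearTriples_bound K hK
  have hC3 : 0 < C ^ ((1 : ℝ) / 3) := Real.rpow_pos_of_pos hC _
  -- One constant for all three claims: C for triples, 3C^(1/3) and 1 for incidences, and 2304 C² =
  -- 9 · 256 C² for lines.
  refine ⟨C + 3 * C ^ ((1 : ℝ) / 3) + 1 + 2304 * C ^ 2, by positivity, ?_⟩
  intro F _ _ A B hB hBA hG
  have hT := hbound F A B hB hBA hG
  have hN : (0 : ℝ) < A.card := by exact_mod_cast (by omega : 0 < A.card)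
  have hn : (0 : ℝ) < B.card := by exact_mod_cast (by omega : 0 < B.card)
  have hq : (0 : ℝ) < Fintype.card F := by exact_mod_cast Fintype.card_pos
  have h2 : 2 ≤ A.card * B.card := by nlinarith
  refine ⟨hT.trans ?_, fun L hL => ?_, ?_⟩
  · gcongr
    nlinarith
  · refine (incidences_le A B L hL (by positivity) hT).trans ?_
    have h3 := rpow_one_third_collinear_bound hC.le hN.le hn.le hq.le
    set t := (C * ((A.card : ℝ) ^ ((383 : ℝ) / 191) * (B.card : ℝ) ^ ((571 : ℝ) / 191)
      + (Fintype.card F : ℝ) ^ (-(1 : ℝ) / 103) * (A.card : ℝ) ^ ((207 : ℝ) / 103) * (B.card : ℝ) ^ 3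
      + (A.card : ℝ) ^ 3 * (B.card : ℝ))) ^ ((1 : ℝ) / 3)
    set w := (A.card : ℝ) ^ ((383 : ℝ) / 573) * (B.card : ℝ) ^ ((571 : ℝ) / 573)
      + (Fintype.card F : ℝ) ^ (-(1 : ℝ) / 309) * (A.card : ℝ) ^ ((207 : ℝ) / 309) * (B.card : ℝ)
      + (A.card : ℝ) * (B.card : ℝ) ^ ((1 : ℝ) / 3)
    have hw : 0 ≤ w := by positivity
    have hx : 0 ≤ (L.card : ℝ) ^ ((2 : ℝ) / 3) := by positivity
    have hL0 : (0 : ℝ) ≤ L.card := by positivity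
    generalize C ^ ((1 : ℝ) / 3) = C₃ at h3 hC3 ⊢
    generalize (L.card : ℝ) ^ ((2 : ℝ) / 3) = x at hx ⊢
    generalize (L.card : ℝ) = y at hL0 ⊢
    clear_value t w
    calc 3 * (t * x) + y ≤ 3 * (C₃ * w * x) + y := by gcongr
      _ = 3 * C₃ * (w * x) + 1 * y := by ring
      _ ≤ (C + 3 * C₃ + 1 + 2304 * C ^ 2) * (w * x) +
          (C + 3 * C₃ + 1 + 2304 * C ^ 2) * y := by
        gcongr <;> nlinarith [sq_nonneg C]
      _ = _ := by ring
  · have h3 := card_pow_six_le A B h2 (by positivity) hT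
    have h4 := min_mul_sq_collinear_bound_le (C := C) hN hn hq
    have hpos : 0 < (C * ((A.card : ℝ) ^ ((383 : ℝ) / 191) * (B.card : ℝ) ^ ((571 : ℝ) / 191)
      + (Fintype.card F : ℝ) ^ (-(1 : ℝ) / 103) * (A.card : ℝ) ^ ((207 : ℝ) / 103) * (B.card : ℝ) ^ 3
      + (A.card : ℝ) ^ 3 * (B.card : ℝ))) ^ 2 := by positivity
    have h5 := h4.trans (mul_le_mul_of_nonneg_left h3 (by positivity : 0 ≤ 9 * C ^ 2))
    refine le_of_mul_le_mul_right (h5.trans ?_) hpos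
    have hl : (0 : ℝ) ≤ linesDetermined (A ×ˢ B) := by positivity
    generalize (C * ((A.card : ℝ) ^ ((383 : ℝ) / 191) * (B.card : ℝ) ^ ((571 : ℝ) / 191)
      + (Fintype.card F : ℝ) ^ (-(1 : ℝ) / 103) * (A.card : ℝ) ^ ((207 : ℝ) / 103) * (B.card : ℝ) ^ 3
      + (A.card : ℝ) ^ 3 * (B.card : ℝ))) = t at hpos ⊢
    calc 9 * C ^ 2 * (256 * t ^ 2 * linesDetermined (A ×ˢ B)) =
          (2304 * C ^ 2) * linesDetermined (A ×ˢ B) * t ^ 2 := by ring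
      _ ≤ _ := by
        gcongr
        linarith
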